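/- Let $\mathbb{K}$ be an algebraically closed field of characteristic zero, and let $X$ be an affine toric variety, i.e. an irreducible affine algebraic variety over $\mathbb{K}$ (not necessarily normal) with an algebraic action of a torus $T=(\mathbb{K}^\times)^n$ that has an open orbit. The variety $X$ is called rigid if every algebraic action of the additive group $\mathbb{G}_a=(\mathbb{K},+)$ on $X$ is trivial. Then $X$ is rigid if and only if its smooth locus $X^{\mathrm{reg}}$ coincides with the open $T$-orbit. Suppose moreover that the action of $T$ on $X$ is effective. Let $M=\mathbb{Z}^n$ be the character lattice of $T$, where $m\in M$ corresponds to the character $\chi^m(t)=t_1^{m_1}\cdots t_n^{m_n}$, and let $P\subseteq M$ be the weight monoid of $X$: the set of all $m\in M$ for which there is a nonzero regular function $f$ on $X$ with $f(t\cdot x)=\chi^m(t)f(x)$ for all $t\in T$, $x\in X$. Let $\sigma^\vee=\mathbb{Q}_{\ge 0}P\subseteq M\otimes_{\mathbb{Z}}\mathbb{Q}$. An element $p\in P$ is called a saturation point of $P$ if $(p+\sigma^\vee)\cap M\subseteq P$, and a face $\tau$ of $\sigma^\vee$ is called nowhere saturated if it contains no saturation point of $P$. Then $X$ is rigid if and only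 if every face of codimension one of $\sigma^\vee$ is nowhere saturated. -/

import Mathlib

noncomputable section

namespace ToricRigidity

/-! ### Algebraic group actions on an affine variety

An affine variety `X` over an algebraically closed field `K` is given by its algebra of regular
functions `A = K[X]`. Its points are the `K`-algebra homomorphisms `A → K`, a function `f : A`
having the value `x f` at the point `x`. -/

section Actions

variable {K : Type*} [Field K] {A : Type*} [CommRing A] [Algebra K A]
variable {G : Type*} [CommGroup G]

/-- An action of a commutative group `G` on `X`, given by the pullback of functions
`(φ g f)(x) = f (g • x)`, is algebraic if the map `G × X → X`, `(g, x) ↦ g • x`, is a morphism: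
the pullback of each regular function `f` on `X` is a regular function on `G × X`, that is, a
finite sum `∑ h i (g) * a i (x)` with `h i` in the algebra `O` of regular functions on `G` and
`a i` in `A`. -/
def IsAlgebraicAction (O : Subalgebra K (G → K)) (φ : G →* (A ≃ₐ[K] A)) : Prop :=
  ∀ f : A, ∃ (N : ℕ) (h : Fin N → G → K) (a : Fin N → A),
    (∀ i, h i ∈ O) ∧ ∀ g : G, φ g f = ∑ i, h i g • a i

/-- The orbit of the point `x` under the action with pullback of functions `φ`. -/
def orbit (φ : G →* (A ≃ₐ[K] A)) (x : A →ₐ[K] K) : Set (A →ₐ[K] K) :=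
  {y | ∃ g : G, ∀ f : A, y f = x (φ g f)}

/-- The closed point of `Spec A` that belongs to the point `x` of the variety, namely the kernel
of `x`. -/
def toSpec (x : A →ₐ[K] K) : PrimeSpectrum A :=
  ⟨RingHom.ker x, RingHom.ker_isPrime x⟩

/-- Open subsets of the set of points of the variety, in the Zariski topology. -/
def IsZariskiOpen (U : Set (A →ₐ[K] K)) : Prop :=
  ∃ V : Set (PrimeSpectrum A), IsOpen V ∧ U = toSpec ⁻¹' V

variable (K A)

/-- The set of smooth points of the variety `X`. -/
def smoothPoints : Set (A →ₐ[K] K) :=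
  toSpec ⁻¹' Algebra.smoothLocus K A

/-- The polynomial functions on the additive group `𝔾ₐ` of the field `K`. -/
def gaFunctions : Subalgebra K (Multiplicative K → K) :=
  Algebra.adjoin K {fun s => s.toAdd}

/-- `X` is rigid: it admits no nontrivial algebraic `𝔾ₐ`-action. -/
def IsRigid : Prop :=
  ∀ φ : Multiplicative K →* (A ≃ₐ[K] A), IsAlgebraicAction (gaFunctions K) φ → φ = 1

/-- The Laurent polynomial functions on the torus `(Kˣ)ⁿ`. -/
def torusFunctions (n : ℕ) : Subalgebra K ((Fin n → Kˣ) → K) :=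
  Algebra.adjoin K (Set.range (fun i t => (t i : K)) ∪ Set.range (fun i t => ((t i)⁻¹ : K)))

end Actions

/-! ### The weight monoid and its cone -/

section Weights

variable {K : Type*} [Field K] {A : Type*} [CommRing A] [Algebra K A] {n : ℕ}

/-- The character `χ^m` of the torus `(Kˣ)ⁿ`. -/
def character (m : Fin n → ℤ) (t : Fin n → Kˣ) : Kˣ :=
  ∏ i, t i ^ m i

/-- The monoid of weights of the nonzero semi-invariant regular functions. -/
def weightMonoid [IsDomain A] (φ : (Fin n → Kˣ) →* (A ≃ₐ[K] A)) : AddSubmonoid (Fin n → ℤ) where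
  carrier := {m | ∃ f : A, f ≠ 0 ∧ ∀ t, φ t f = (character m t : K) • f}
  zero_mem' := ⟨1, one_ne_zero, fun t => by simp [character]⟩
  add_mem' := by
    rintro m m' ⟨f, hf, hft⟩ ⟨f', hf', hft'⟩
    refine ⟨f * f', mul_ne_zero hf hf', fun t => ?_⟩
    have hc : character (m + m') t = character m t * character m' t := by
      simp [character, zpow_add, Finset.prod_mul_distrib]
    rw [map_mul, hft, hft', hc, Units.val_mul, smul_mul_smul_comm]

/-- The inclusion of the lattice `M = ℤⁿ` into `M_ℚ = ℚⁿ`. -/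
def toRat (m : Fin n → ℤ) : Fin n → ℚ := fun i => (m i : ℚ)

/-- The cone `σ^∨` generated in `M_ℚ` by a monoid `P ⊆ M`. -/
def weightCone (P : AddSubmonoid (Fin n → ℤ)) : PointedCone ℚ (Fin n → ℚ) :=
  PointedCone.hull ℚ (toRat '' (P : Set (Fin n → ℤ)))

/-- `τ` is a face of codimension one of the cone `C`. -/
def IsFacet (τ C : PointedCone ℚ (Fin n → ℚ)) : Prop :=
  τ.IsFaceOf C ∧
    Module.finrank ℚ (Submodule.span ℚ (τ : Set (Fin n → ℚ))) + 1 =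
      Module.finrank ℚ (Submodule.span ℚ (C : Set (Fin n → ℚ)))

/-- `p` is a saturation point of `P`: it lies in `P`, and `(p + σ^∨) ∩ M ⊆ P`. -/
def IsSaturationPoint (P : AddSubmonoid (Fin n → ℤ)) (p : Fin n → ℤ) : Prop :=
  p ∈ P ∧ ∀ m : Fin n → ℤ, (∃ c ∈ weightCone P, toRat m = toRat p + c) → m ∈ P

/-- A face of `σ^∨` is almost saturated if it contains a saturation point of `P`. -/
def IsAlmostSaturated (P : AddSubmonoid (Fin n → ℤ)) (τ : PointedCone ℚ (Fin n → ℚ)) : Prop :=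
  ∃ p, IsSaturationPoint P p ∧ toRat p ∈ τ

/-- A face of `σ^∨` is nowhere saturated if it is not almost saturated. -/
def IsNowhereSaturated (P : AddSubmonoid (Fin n → ℤ)) (τ : PointedCone ℚ (Fin n → ℚ)) : Prop :=
  ¬ IsAlmostSaturated P τ

end Weights

end ToricRigidity

end

/-! The open orbit makes every weight space at most a line, so the algebra has a multiplicative
basis `b p` indexed by a finitely generated monoid `P` (`exists_weight_basis`, `fg_of_basis`), and
the orbit is the set where no `b p` vanishes (`mem_orbit_iff_forall_ne_zero`). In characteristic
zero a nontrivial 𝔾ₐ-action exists exactly when there is a nonzero locally nilpotent derivation: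
exponentiate one way, take the linear coefficient the other way.

Let x be a smooth point off the orbit. Its local ring has no nonzero proper ideal stable under all
derivations (`eq_bot_of_derivation_stable`), so some derivation moves the ideal generated by the `b
p` vanishing at x. A homogeneous component then sends such a p to a q with `b q` nonzero at x. By
Krull's intersection theorem q - p cannot be added forever within `P`, so this component is locally
nilpotent and X is not rigid. Conversely, if the smooth locus is the orbit, every 𝔾ₐ-action
preserves it; along a 𝔾ₐ-orbit in it `b p` is a polynomial without zeros, hence constant.

For the facet criterion, the lexicographically leading component of a locally nilpotent derivation
has the form χ^p ↦ ℓ(p) χ^(p+e), and nilpotency makes ℓ proportional to an integral form L with L(e)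
= -1 that is nonnegative on `P` (`exists_degree_of_derivation`, `exists_integral_form`). The
equation L = 0 cuts out a facet, and sliding a saturation point along e places one on it
(`exists_facet_of_degree`). In the other direction, a saturation point on a facet leaves room for a
degree e that lowers the facet form, yet keeps every weight off the facet inside `P`
(`exists_degree_of_isAlmostSaturated`). -/

namespace ToricRigidity

/-! ### Differential simplicity of smooth local rings. -/

section LocalAlgebra

open IsLocalRing

/-- At a smooth rational point there is a derivation of the local ring, given by a linear map on
the differentials, that agrees with the identity to first order. -/
theorem exists_euler_linearMap {K R : Type*} [Field K] [CommRing R] [IsLocalRing R] [Algebra K R]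
    [Algebra.FormallySmooth K R] (π : R →ₐ[K] K) :
    ∃ E : Ω[R⁄K] →ₗ[R] maximalIdeal R, ∀ y ∈ maximalIdeal R,
      (E (KaehlerDifferential.D K R y) : R) - y ∈ maximalIdeal R ^ 2 := by
  have hker : ∀ y, y ∈ maximalIdeal R ↔ π y = 0 := by
    have hsurj : Function.Surjective π := fun c => ⟨algebraMap K R c, by simp⟩
    have := RingHom.ker_isMaximal_of_surjective π.toRingHom hsurj
    have h := eq_maximalIdeal this
    intro y
    rw [← h]
    rfl
  have hmem : ∀ y, y - algebraMap K R (π y) ∈ maximalIdeal R := fun y => by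
    rw [hker]; simp
  let L : R →ₗ[K] (maximalIdeal R).Cotangent :=
    { toFun := fun y => (maximalIdeal R).toCotangent ⟨y - algebraMap K R (π y), hmem y⟩
      map_add' := fun a b => by
        rw [← map_add]
        congr 1
        ext
        simp only [map_add, Submodule.coe_add]
        ring
      map_smul' := fun c a => by
        rw [RingHom.id_apply, ← algebraMap_smul R c ((maximalIdeal R).toCotangent _), ← map_smul]
        congr 1
        ext
        simp only [smul_eq_mul, map_mul, Submodule.coe_smul, Algebra.smul_def, AlgHom.commutes,
          Algebra.algebraMap_self, RingHom.id_apply]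
        ring }
  let D : Derivation K R (maximalIdeal R).Cotangent := Derivation.mk' L fun a b => by
    change (maximalIdeal R).toCotangent _ = a • (maximalIdeal R).toCotangent _ +
      b • (maximalIdeal R).toCotangent _
    rw [← map_smul, ← map_smul, ← map_add, Ideal.toCotangent_eq]
    have h : -((a - algebraMap K R (π a)) * (b - algebraMap K R (π b))) ∈ maximalIdeal R ^ 2 := by
      rw [pow_two]
      exact neg_mem (Ideal.mul_mem_mul (hmem a) (hmem b))
    convert h using 1
    simp only [Submodule.coe_add, Submodule.coe_smul, smul_eq_mul, map_mul]
    ring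
  -- Formal smoothness makes `Ω[R⁄K]` projective, so the map to m/m² induced by `D` lifts to m.
  obtain ⟨E, hE⟩ := Module.projective_lifting_property (maximalIdeal R).toCotangent
    D.liftKaehlerDifferential (maximalIdeal R).toCotangent_surjective
  refine ⟨E, fun y hy => ?_⟩
  have h1 : (maximalIdeal R).toCotangent (E (KaehlerDifferential.D K R y)) =
      (maximalIdeal R).toCotangent ⟨y - algebraMap K R (π y), hmem y⟩ := by
    rw [← LinearMap.comp_apply, hE, Derivation.liftKaehlerDifferential_comp_D]
    rfl
  rw [Ideal.toCotangent_eq] at h1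
  rw [hker] at hy
  simpa [hy] using h1

/-- As with Euler's formula, the Leibniz rule adds eigenvalues: `E` acts as 1 on m/m², hence as k on
products of k factors modulo the next power. -/
theorem euler_sub_nsmul_mem {K R : Type*} [Field K] [CommRing R] [IsLocalRing R] [Algebra K R]
    (E : Derivation K R R) (hE0 : ∀ y, E y ∈ maximalIdeal R)
    (hE : ∀ y ∈ maximalIdeal R, E y - y ∈ maximalIdeal R ^ 2) (k : ℕ) :
    ∀ y ∈ maximalIdeal R ^ k, E y - (k : R) * y ∈ maximalIdeal R ^ (k + 1) := by
  induction k with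
  | zero => intro y _; simpa using hE0 y
  | succ k ih =>
    intro y hy
    rw [pow_succ'] at hy
    refine Submodule.mul_induction_on hy (fun a ha b hb => ?_) (fun a b ha hb => ?_)
    · have h1 : a * (E b - k * b) ∈ maximalIdeal R ^ (k + 1 + 1) := by
        rw [pow_succ' _ (k + 1)]
        exact Ideal.mul_mem_mul ha (ih b hb)
      have h2 : b * (E a - a) ∈ maximalIdeal R ^ (k + 1 + 1) := by
        rw [add_assoc, pow_add]
        exact Ideal.mul_mem_mul hb (hE a ha)
      convert add_mem h1 h2 using 1
      simp only [Derivation.leibniz, smul_eq_mul]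
      push_cast
      ring
    · convert add_mem ha hb using 1
      rw [map_add]
      ring

/-- The local ring of a smooth rational point in characteristic zero is differentially simple. -/
theorem eq_bot_of_derivation_stable {K R : Type*} [Field K] [CharZero K] [CommRing R]
    [IsLocalRing R] [IsNoetherianRing R] [Algebra K R] [Algebra.EssFiniteType K R]
    [Algebra.FormallySmooth K R] (π : R →ₐ[K] K) (J : Ideal R) (hJ : J ≠ ⊤)
    (hD : ∀ D : Derivation K R R, ∀ f ∈ J, D f ∈ J) : J = ⊥ := by
  obtain ⟨E', hE'⟩ := exists_euler_linearMap π
  have : Module.Free R Ω[R⁄K] := Module.free_of_flat_of_isLocalRing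
  let b := Module.Free.chooseBasis R Ω[R⁄K]
  let E : Derivation K R R :=
    ((maximalIdeal R).subtype ∘ₗ E').compDer (KaehlerDifferential.D K R)
  have hE1 : ∀ y, E y ∈ maximalIdeal R := fun y => (E' _).2
  -- `E` is a combination, with coefficients in m, of the derivations dual to a basis of the
  -- differentials. Those preserve `J`, so `E` gains one power of m on it.
  have hE2 : ∀ k, J ≤ maximalIdeal R ^ k → ∀ f ∈ J, E f ∈ maximalIdeal R ^ (k + 1) := by
    intro k hk f hf
    have h : E f = ∑ i, (b.coord i).compDer (KaehlerDifferential.D K R) f * (E' (b i) : R) := by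
      change ((E' (KaehlerDifferential.D K R f) : maximalIdeal R) : R) = _
      conv_lhs => rw [← b.sum_repr (KaehlerDifferential.D K R f)]
      rw [map_sum, AddSubmonoidClass.coe_finsetSum]
      exact Finset.sum_congr rfl fun i _ => by rw [map_smul]; rfl
    rw [h]
    refine sum_mem fun i _ => ?_
    rw [pow_succ]
    exact Ideal.mul_mem_mul (hk (hD _ f hf)) (E' (b i)).2
  -- In the induction step `E f` lies one power deeper but is also (k + 1)f modulo that power; as k
  -- + 1 is a unit, f itself lies deeper. Krull's theorem then finishes.
  have hpow : ∀ k, J ≤ maximalIdeal R ^ (k + 1) := by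
    intro k
    induction k with
    | zero => simpa using le_maximalIdeal hJ
    | succ k ih =>
      intro f hf
      have h1 := euler_sub_nsmul_mem E hE1 hE' (k + 1) f (ih hf)
      have h2 := sub_mem (hE2 _ ih f hf) h1
      rw [sub_sub_cancel] at h2
      have h3 : IsUnit ((k + 1 : ℕ) : R) := by
        have : IsUnit ((k + 1 : ℕ) : K) := by
          rw [isUnit_iff_ne_zero]; exact_mod_cast Nat.succ_ne_zero k
        simpa using this.map (algebraMap K R)
      exact (Ideal.unit_mul_mem_iff_mem _ h3).1 h2
  rw [eq_bot_iff, ← Ideal.iInf_pow_eq_bot_of_isLocalRing (maximalIdeal R) (Ideal.IsPrime.ne_top'),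
    le_iInf_iff]
  intro k
  exact (hpow k).trans (Ideal.pow_le_pow_right k.le_succ)

end LocalAlgebra

/-! ### Rational points and smooth points of an affine variety. -/

section Points

variable {K : Type*} [Field K] {A : Type*} [CommRing A] [Algebra K A]

/-- The rational points of an affine variety over an algebraically closed field are dense. -/
theorem exists_point_ne_zero [IsAlgClosed K] [IsDomain A] [Algebra.FiniteType K A] {g : A}
    (hg : g ≠ 0) : ∃ y : A →ₐ[K] K, y g ≠ 0 := by
  have hle : Submonoid.powers g ≤ nonZeroDivisors A := powers_le_nonZeroDivisors_of_noZeroDivisors hg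
  have : Nontrivial (Localization.Away g) :=
    (IsLocalization.injective (Localization.Away g) hle).nontrivial
  obtain ⟨m, hm⟩ := Ideal.exists_maximal (Localization.Away g)
  have : Algebra.FiniteType A (Localization.Away g) :=
    IsLocalization.finiteType_of_monoid_fg (Submonoid.powers g) _
  have : Algebra.FiniteType K (Localization.Away g) :=
    .trans (‹_› : Algebra.FiniteType K A) this
  let := Ideal.Quotient.field m
  have : Algebra.FiniteType K (Localization.Away g ⧸ m) := inferInstance
  have : Module.Finite K (Localization.Away g ⧸ m) := finite_of_finite_type_of_isJacobsonRing _ _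
  have hbij : Function.Bijective (algebraMap K (Localization.Away g ⧸ m)) :=
    IsAlgClosed.algebraMap_bijective_of_isIntegral
  let e := AlgEquiv.ofBijective (Algebra.ofId K (Localization.Away g ⧸ m)) hbij
  refine ⟨(e.symm : _ →ₐ[K] K).comp ((Ideal.Quotient.mkₐ K m).comp
    (IsScalarTower.toAlgHom K A (Localization.Away g))), ?_⟩
  have h : IsUnit (algebraMap A (Localization.Away g) g) :=
    IsLocalization.Away.algebraMap_isUnit g
  exact (h.map ((e.symm : _ →ₐ[K] K).comp (Ideal.Quotient.mkₐ K m))).ne_zero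

theorem mem_ker_toSpec {x : A →ₐ[K] K} {a : A} : a ∈ (toSpec x).asIdeal ↔ x a = 0 := Iff.rfl

/-- A nonzero proper ideal vanishing at a smooth point is not stable under derivations. -/
theorem exists_derivation_notMem [CharZero K] [IsDomain A] [Algebra.FiniteType K A]
    (x : A →ₐ[K] K) (hx : x ∈ smoothPoints K A) (I : Ideal A) (hI0 : I ≠ ⊥)
    (hI : ∀ f ∈ I, x f = 0) : ∃ D : Derivation K A A, ∃ f ∈ I, D f ∉ I := by
  by_contra! hcon
  let p := (toSpec x).asIdeal
  let R := Localization.AtPrime p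
  have : Algebra.FormallySmooth K R := hx
  have : IsNoetherianRing A := Algebra.FiniteType.isNoetherianRing K A
  have : IsNoetherianRing R := IsLocalization.isNoetherianRing p.primeCompl R ‹_›
  have : Algebra.EssFiniteType A R := .of_isLocalization _ p.primeCompl
  have : Algebra.EssFiniteType K R := .comp _ A _
  have hinj : Function.Injective (algebraMap A R) :=
    IsLocalization.injective R p.primeCompl_le_nonZeroDivisors
  let π : R →ₐ[K] K := IsLocalization.liftAlgHom (M := p.primeCompl) (f := x) fun y =>
    isUnit_iff_ne_zero.2 fun h => y.2 h
  have hJ : I.map (algebraMap A R) ≠ ⊤ := by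
    intro h
    have hle : I.map (algebraMap A R) ≤ IsLocalRing.maximalIdeal R := by
      rw [Ideal.map_le_iff_le_comap]
      exact fun f hf => (IsLocalization.AtPrime.to_map_mem_maximal_iff R p f).2 (hI f hf)
    exact (IsLocalRing.maximalIdeal.isMaximal R).ne_top (top_le_iff.1 (h ▸ hle))
  refine hI0 ?_
  rw [← Ideal.map_eq_bot_iff_of_injective hinj]
  refine eq_bot_of_derivation_stable π _ hJ fun D j hj => ?_
  -- `D` need not preserve `A`, but on the finitely many generators its values have a common
  -- denominator s, so sD restricts to a derivation of `A`, and s is a unit in `R`.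
  have hgen : ∀ f ∈ I, D (algebraMap A R f) ∈ I.map (algebraMap A R) := by
    obtain ⟨S, hS⟩ := ‹Algebra.FiniteType K A›.out
    classical
    obtain ⟨s, hs⟩ := IsLocalization.exist_integer_multiples_of_finset p.primeCompl
      (S.image fun a => D (algebraMap A R a))
    have hint : ∀ a : A, ∃ a' : A, algebraMap A R a' = algebraMap A R s * D (algebraMap A R a) := by
      intro a
      have ha : a ∈ Algebra.adjoin K (S : Set A) := hS ▸ Algebra.mem_top
      induction ha using Algebra.adjoin_induction with
      | mem a ha =>
        obtain ⟨a', ha'⟩ := hs _ (Finset.mem_image_of_mem _ ha)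
        exact ⟨a', by rw [ha', Algebra.smul_def]⟩
      | algebraMap r =>
        refine ⟨0, ?_⟩
        rw [← IsScalarTower.algebraMap_apply K A R]
        simp
      | add a b _ _ ha hb =>
        obtain ⟨a', ha⟩ := ha
        obtain ⟨b', hb⟩ := hb
        exact ⟨a' + b', by rw [map_add, ha, hb, map_add, map_add]; ring⟩
      | mul a b _ _ ha hb =>
        obtain ⟨a', ha⟩ := ha
        obtain ⟨b', hb⟩ := hb
        refine ⟨a * b' + b * a', ?_⟩
        rw [map_add, map_mul, map_mul, ha, hb, map_mul, Derivation.leibniz]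
        simp only [smul_eq_mul]
        ring
    choose d hd using hint
    have hsmul : ∀ (c : K) (a : A), algebraMap A R (c • a) = c • algebraMap A R a := fun c a =>
      map_smul (IsScalarTower.toAlgHom K A R) c a
    let D' : Derivation K A A := Derivation.mk'
      { toFun := d
        map_add' := fun a b => hinj (by rw [map_add, hd, hd, hd, map_add, map_add]; ring)
        map_smul' := fun c a => hinj (by
          rw [RingHom.id_apply, hsmul, hd, hd, hsmul, D.map_smul, mul_smul_comm]) }
      fun a b => hinj (by
        change algebraMap A R (d _) = algebraMap A R (a * d b + b * d a)
        rw [map_add, map_mul, map_mul, hd, hd, hd, map_mul, Derivation.leibniz]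
        simp only [smul_eq_mul]
        ring)
    intro f hf
    have h1 : algebraMap A R (D' f) ∈ I.map (algebraMap A R) :=
      Ideal.mem_map_of_mem _ (hcon D' f hf)
    have h2 : algebraMap A R (D' f) = algebraMap A R s * D (algebraMap A R f) := hd f
    rw [h2] at h1
    exact (Ideal.unit_mul_mem_iff_mem _ (IsLocalization.map_units R s)).1 h1
  refine Submodule.span_induction (p := fun j _ => D j ∈ I.map (algebraMap A R)) ?_ ?_ ?_ ?_ hj
  · rintro _ ⟨f, hf, rfl⟩
    exact hgen f hf
  · simp
  · intro a b _ _ ha hb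
    rw [map_add]
    exact add_mem ha hb
  · intro r a ha hDa
    rw [smul_eq_mul, Derivation.leibniz]
    exact add_mem (Ideal.mul_mem_left _ _ hDa) (by
      rw [smul_eq_mul, mul_comm]; exact Ideal.mul_mem_left _ _ ha)

/-- Krull's intersection theorem at a rational point. -/
theorem eq_zero_of_mul_mem_pow [IsDomain A] [Algebra.FiniteType K A] (x : A →ₐ[K] K) {a u w : A}
    (hu : x u ≠ 0) (hw : x w = 0) (h : ∀ k : ℕ, ∃ c, c * w ^ k = a * u ^ k) : a = 0 := by
  let p := (toSpec x).asIdeal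
  let R := Localization.AtPrime p
  have : IsNoetherianRing A := Algebra.FiniteType.isNoetherianRing K A
  have : IsNoetherianRing R := IsLocalization.isNoetherianRing p.primeCompl R ‹_›
  have hinj : Function.Injective (algebraMap A R) :=
    IsLocalization.injective R p.primeCompl_le_nonZeroDivisors
  -- Locally u is a unit and w lies in the maximal ideal, so a is divisible by every power of w.
  have hmem : algebraMap A R a ∈ ⨅ k : ℕ, IsLocalRing.maximalIdeal R ^ k := by
    rw [Submodule.mem_iInf]
    intro k
    obtain ⟨c, hc⟩ := h k
    have hunit : IsUnit (algebraMap A R u ^ k) :=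
      (IsLocalization.map_units R (⟨u, hu⟩ : p.primeCompl)).pow k
    rw [← Ideal.mul_unit_mem_iff_mem _ hunit, ← map_pow, ← map_mul, ← hc, map_mul, map_pow]
    exact Ideal.mul_mem_left _ _
      (Ideal.pow_mem_pow ((IsLocalization.AtPrime.to_map_mem_maximal_iff R p w).2 hw) k)
  rw [Ideal.iInf_pow_eq_bot_of_isLocalRing _ (Ideal.IsPrime.ne_top')] at hmem
  exact hinj (by simpa using hmem)

/-- Automorphisms preserve the smooth points. -/
theorem comp_mem_smoothPoints (σ : A ≃ₐ[K] A) {x : A →ₐ[K] K} (hx : x ∈ smoothPoints K A) :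
    x.comp (σ : A →ₐ[K] A) ∈ smoothPoints K A := by
  have hmap : (toSpec (x.comp (σ : A →ₐ[K] A))).asIdeal.primeCompl.map (σ : A →* A) =
      (toSpec x).asIdeal.primeCompl := by
    ext a
    constructor
    · rintro ⟨b, hb, rfl⟩
      exact hb
    · intro ha
      exact ⟨σ.symm a, fun h => ha (by simpa [mem_ker_toSpec] using h), by simp⟩
  have : Algebra.FormallySmooth K (Localization.AtPrime (toSpec x).asIdeal) := hx
  exact Algebra.FormallySmooth.of_equiv
    (IsLocalization.algEquivOfAlgEquiv (Localization.AtPrime (toSpec (x.comp (σ : A →ₐ[K] A))).asIdeal)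
      (Localization.AtPrime (toSpec x).asIdeal) σ hmap).symm

/-- Generic smoothness. -/
theorem exists_ne_zero_forall_mem_smoothPoints [CharZero K] [IsDomain A] [Algebra.FiniteType K A] :
    ∃ g : A, g ≠ 0 ∧ ∀ x : A →ₐ[K] K, x g ≠ 0 → x ∈ smoothPoints K A := by
  have : IsNoetherianRing A := Algebra.FiniteType.isNoetherianRing K A
  have : Algebra.FinitePresentation K A := Algebra.FinitePresentation.of_finiteType.1 ‹_›
  -- At the generic point the local ring is the fraction field, formally smooth over the perfect
  -- field `K`; openness of the smooth locus does the rest.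
  have hgen : (⊥ : PrimeSpectrum A) ∈ Algebra.smoothLocus K A := by
    have : Algebra.EssFiniteType A (FractionRing A) := .of_isLocalization _ (nonZeroDivisors A)
    have : Algebra.EssFiniteType K (FractionRing A) := .comp _ A _
    have : Algebra.FormallySmooth K (FractionRing A) := Algebra.FormallySmooth.of_perfectField
    have hc : (⊥ : PrimeSpectrum A).asIdeal.primeCompl = nonZeroDivisors A := by
      ext a
      simp [Ideal.primeCompl, mem_nonZeroDivisors_iff_ne_zero]
    have : IsLocalization (⊥ : PrimeSpectrum A).asIdeal.primeCompl (FractionRing A) := by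
      rw [hc]; infer_instance
    exact Algebra.FormallySmooth.of_equiv
      ((IsLocalization.algEquiv (⊥ : PrimeSpectrum A).asIdeal.primeCompl (FractionRing A)
        (Localization.AtPrime (⊥ : PrimeSpectrum A).asIdeal)).restrictScalars K)
  obtain ⟨_, ⟨_, ⟨g, rfl⟩, rfl⟩, hg, hsub⟩ :=
    PrimeSpectrum.isBasis_basic_opens.exists_subset_of_mem_open hgen Algebra.isOpen_smoothLocus
  exact ⟨g, fun h => hg (by simp [h]), fun x hx => hsub hx⟩

/-- A nonempty Zariski open set contains the complement of a hypersurface. -/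
theorem IsZariskiOpen.exists_ne_zero {U : Set (A →ₐ[K] K)} (hU : IsZariskiOpen U) {x : A →ₐ[K] K}
    (hx : x ∈ U) : ∃ g : A, g ≠ 0 ∧ ∀ y : A →ₐ[K] K, y g ≠ 0 → y ∈ U := by
  obtain ⟨V, hV, rfl⟩ := hU
  obtain ⟨_, ⟨_, ⟨g, rfl⟩, rfl⟩, hg, hsub⟩ :=
    PrimeSpectrum.isBasis_basic_opens.exists_subset_of_mem_open (show toSpec x ∈ V from hx) hV
  exact ⟨g, fun h => hg (by simp [h]), fun y hy => hsub hy⟩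

end Points

/-! ### Additive group actions and locally nilpotent derivations. -/

section AdditiveGroup

open Polynomial

variable {K : Type*} [Field K] {A : Type*} [CommRing A] [Algebra K A]

theorem polynomial_eq_of_forall_eval [Infinite K] [IsDomain A] {p q : A[X]}
    (h : ∀ s : K, p.eval (algebraMap K A s) = q.eval (algebraMap K A s)) : p = q := by
  refine Polynomial.eq_of_infinite_eval_eq p q
    ((Set.infinite_range_of_injective (algebraMap K A).injective).mono ?_)
  rintro _ ⟨s, rfl⟩
  exact h s

section Exponential

/-- Treating exp(XD)a as a polynomial over `A` turns the group law of the action into Taylor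
expansion. -/
theorem exists_expPolynomial (D : Derivation K A A) (hD : ∀ a, ∃ k, D^[k] a = 0) (a : A) :
    ∃ p : A[X], ∀ k, p.coeff k = ((k.factorial : K)⁻¹) • D^[k] a := by
  obtain ⟨N, hN⟩ := hD a
  refine ⟨∑ i ∈ Finset.range N, monomial i (((i.factorial : K)⁻¹) • D^[i] a), fun k => ?_⟩
  rw [finsetSum_coeff]
  simp only [coeff_monomial]
  rw [Finset.sum_ite_eq' (Finset.range N) k]
  split_ifs with h
  · rfl
  · rw [Finset.mem_range, not_lt] at h
    obtain ⟨j, rfl⟩ := Nat.exists_eq_add_of_le' h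
    rw [Function.iterate_add_apply, hN, iterate_map_zero, smul_zero]

/-- The polynomial `∑ Xᵏ Dᵏ(a) / k!`. -/
noncomputable def expPolynomial (D : Derivation K A A) (hD : ∀ a, ∃ k, D^[k] a = 0) (a : A) : A[X] :=
  (exists_expPolynomial D hD a).choose

variable (D : Derivation K A A) (hD : ∀ a, ∃ k, D^[k] a = 0)

theorem coeff_expPolynomial (a : A) (k : ℕ) :
    (expPolynomial D hD a).coeff k = ((k.factorial : K)⁻¹) • D^[k] a :=
  (exists_expPolynomial D hD a).choose_spec k

theorem expPolynomial_add (a b : A) :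
    expPolynomial D hD (a + b) = expPolynomial D hD a + expPolynomial D hD b := by
  ext k
  simp only [coeff_add, coeff_expPolynomial, iterate_map_add, smul_add]

theorem iterate_derivation_mul_eq_sum_choose (a b : A) (k : ℕ) :
    D^[k] (a * b) =
      ∑ ij ∈ Finset.HasAntidiagonal.antidiagonal k, k.choose ij.1 • (D^[ij.1] a * D^[ij.2] b) := by
  induction k with
  | zero => simp
  | succ k ih =>
    rw [Function.iterate_succ_apply', ih, map_sum,
      Finset.sum_antidiagonal_choose_succ_nsmul (fun i j => D^[i] a * D^[j] b),
      ← Finset.sum_add_distrib]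
    refine Finset.sum_congr rfl fun ij hij => ?_
    rw [map_nsmul, Derivation.leibniz, smul_eq_mul, smul_eq_mul, Function.iterate_succ_apply',
      Function.iterate_succ_apply', ← Nat.choose_symm_of_eq_add (Finset.HasAntidiagonal.mem_antidiagonal.1 hij).symm,
      smul_add, mul_comm (D^[ij.2] b)]

theorem iterate_derivation_mul [CharZero K] (a b : A) (k : ℕ) :
    ((k.factorial : K)⁻¹) • D^[k] (a * b) = ∑ ij ∈ Finset.HasAntidiagonal.antidiagonal k,
      (((ij.1.factorial : K)⁻¹) • D^[ij.1] a) * (((ij.2.factorial : K)⁻¹) • D^[ij.2] b) := by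
  rw [iterate_derivation_mul_eq_sum_choose, Finset.smul_sum]
  refine Finset.sum_congr rfl fun ij hij => ?_
  rw [← Finset.HasAntidiagonal.mem_antidiagonal.1 hij, smul_mul_smul_comm, ← Nat.cast_smul_eq_nsmul K, smul_smul]
  congr 1
  have h1 : (ij.1.factorial : K) ≠ 0 := Nat.cast_ne_zero.2 ij.1.factorial_ne_zero
  have h2 : (ij.2.factorial : K) ≠ 0 := Nat.cast_ne_zero.2 ij.2.factorial_ne_zero
  have h3 : ((ij.1 + ij.2).factorial : K) ≠ 0 := Nat.cast_ne_zero.2 (Nat.factorial_ne_zero _)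
  rw [Nat.cast_add_choose]
  field_simp

theorem expPolynomial_mul [CharZero K] (a b : A) :
    expPolynomial D hD (a * b) = expPolynomial D hD a * expPolynomial D hD b := by
  ext k
  simp only [coeff_mul, coeff_expPolynomial, iterate_derivation_mul]

theorem expPolynomial_algebraMap (c : K) :
    expPolynomial D hD (algebraMap K A c) = C (algebraMap K A c) := by
  ext k
  rw [coeff_expPolynomial, coeff_C]
  cases k with
  | zero => simp
  | succ k => simp [Function.iterate_succ_apply, iterate_map_zero]

theorem expPolynomial_derivation [CharZero K] (a : A) :
    expPolynomial D hD (D a) = derivative (expPolynomial D hD a) := by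
  ext k
  rw [coeff_derivative, coeff_expPolynomial, coeff_expPolynomial, ← Function.iterate_succ_apply,
    ← Nat.cast_succ, ← nsmul_eq_mul', ← Nat.cast_smul_eq_nsmul K, smul_smul, Nat.factorial_succ,
    Nat.cast_mul, mul_inv, ← mul_assoc, mul_inv_cancel₀ (Nat.cast_ne_zero.2 k.succ_ne_zero), one_mul]

/-- The exponential `exp (s D)` of a locally nilpotent derivation. -/
noncomputable def expHom [CharZero K] (s : K) : A →ₐ[K] A where
  toFun a := (expPolynomial D hD a).eval (algebraMap K A s)
  map_one' := by rw [← map_one (algebraMap K A), expPolynomial_algebraMap, eval_C]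
  map_zero' := by rw [← map_zero (algebraMap K A), expPolynomial_algebraMap, eval_C]
  map_add' a b := by rw [expPolynomial_add, eval_add]
  map_mul' a b := by rw [expPolynomial_mul, eval_mul]
  commutes' c := by rw [expPolynomial_algebraMap, eval_C]

theorem expHom_apply [CharZero K] (s : K) (a : A) :
    expHom D hD s a = (expPolynomial D hD a).eval (algebraMap K A s) := rfl

theorem derivation_expHom [CharZero K] (s : K) (a : A) :
    D (expHom D hD s a) = expHom D hD s (D a) := by
  have h : ∀ b, ∀ N, (expPolynomial D hD b).natDegree < N → expHom D hD s b =
      ∑ i ∈ Finset.range N, ((i.factorial : K)⁻¹ * s ^ i) • D^[i] b := by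
    intro b N hN
    rw [expHom_apply, eval_eq_sum_range' hN]
    refine Finset.sum_congr rfl fun i _ => ?_
    rw [coeff_expPolynomial, ← map_pow, mul_comm, ← Algebra.smul_def, smul_smul, mul_comm]
  rw [h a _ (Nat.lt_succ_of_le (le_max_left _ (expPolynomial D hD (D a)).natDegree)),
    h (D a) _ (Nat.lt_succ_of_le (le_max_right (expPolynomial D hD a).natDegree _)), map_sum]
  refine Finset.sum_congr rfl fun i _ => ?_
  rw [D.map_smul, ← Function.iterate_succ_apply, Function.iterate_succ_apply']

/-- Applying `D` to a differentiates its polynomial formally, so the coefficients at the shifted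
element are divided derivatives evaluated at s. Evaluation then gives the additivity of the
exponential. -/
theorem expPolynomial_expHom [CharZero K] (s : K) (a : A) :
    expPolynomial D hD (expHom D hD s a) = taylor (algebraMap K A s) (expPolynomial D hD a) := by
  ext k
  have h1 : D^[k] (expHom D hD s a) = expHom D hD s (D^[k] a) :=
    Function.Commute.iterate_left (f := D) (g := expHom D hD s) (derivation_expHom D hD s) k a
  have h2 : expPolynomial D hD (D^[k] a) = derivative^[k] (expPolynomial D hD a) :=
    Function.Semiconj.iterate_right (f := expPolynomial D hD) (ga := D) (gb := derivative)
      (expPolynomial_derivation D hD) k a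
  rw [coeff_expPolynomial, h1, expHom_apply, h2, taylor_coeff, ← factorial_smul_hasseDeriv]
  simp only [LinearMap.smul_apply, eval_smul]
  rw [← Nat.cast_smul_eq_nsmul K, smul_smul,
    inv_mul_cancel₀ (Nat.cast_ne_zero.2 k.factorial_ne_zero), one_smul]

theorem expHom_comp [CharZero K] (s t : K) :
    (expHom D hD s).comp (expHom D hD t) = expHom D hD (s + t) := by
  ext a
  rw [AlgHom.comp_apply, expHom_apply, expPolynomial_expHom, taylor_eval, ← map_add, ← expHom_apply]

theorem expHom_zero [CharZero K] : expHom D hD 0 = AlgHom.id K A := by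
  ext a
  rw [expHom_apply, map_zero, ← coeff_zero_eq_eval_zero, coeff_expPolynomial]
  simp

/-- The action of the additive group given by a locally nilpotent derivation. -/
noncomputable def expAction [CharZero K] : Multiplicative K →* (A ≃ₐ[K] A) where
  toFun s := AlgEquiv.ofAlgHom (expHom D hD s.toAdd) (expHom D hD (-s.toAdd))
    (by rw [expHom_comp, add_neg_cancel, expHom_zero])
    (by rw [expHom_comp, neg_add_cancel, expHom_zero])
  map_one' := by
    ext a
    exact AlgHom.congr_fun (expHom_zero D hD) a
  map_mul' s t := by
    ext a
    exact (AlgHom.congr_fun (expHom_comp D hD s.toAdd t.toAdd) a).symm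

theorem isAlgebraicAction_expAction [CharZero K] :
    IsAlgebraicAction (gaFunctions K) (expAction D hD) := by
  intro f
  refine ⟨(expPolynomial D hD f).natDegree + 1, fun i s => s.toAdd ^ (i : ℕ),
    fun i => (expPolynomial D hD f).coeff i, fun i => ?_, fun s => ?_⟩
  · exact pow_mem (Algebra.subset_adjoin (Set.mem_singleton _)) (i : ℕ)
  · change (expPolynomial D hD f).eval (algebraMap K A s.toAdd) = _
    rw [eval_eq_sum_range, Finset.sum_range]
    refine Finset.sum_congr rfl fun i _ => ?_
    rw [← map_pow, mul_comm, ← Algebra.smul_def]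

/-- A variety with a nonzero locally nilpotent derivation is not rigid. -/
theorem not_isRigid_of_derivation [CharZero K] [IsDomain A] (D : Derivation K A A)
    (hD : ∀ a, ∃ k, D^[k] a = 0) (hD0 : D ≠ 0) : ¬ IsRigid K A := by
  intro h
  refine hD0 (Derivation.ext fun a => ?_)
  have h1 := h _ (isAlgebraicAction_expAction D hD)
  have h2 : expPolynomial D hD a = C a := by
    refine polynomial_eq_of_forall_eval (K := K) fun s => ?_
    rw [eval_C]
    exact AlgEquiv.congr_fun (DFunLike.congr_fun h1 (Multiplicative.ofAdd s)) a
  have h3 := coeff_expPolynomial D hD a 1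
  rw [h2, coeff_C] at h3
  simpa using h3.symm

end Exponential

section Coaction

variable {φ : Multiplicative K →* (A ≃ₐ[K] A)}

theorem IsAlgebraicAction.exists_polynomial (hφ : IsAlgebraicAction (gaFunctions K) φ) (f : A) :
    ∃ p : A[X], ∀ s : K, φ (Multiplicative.ofAdd s) f = p.eval (algebraMap K A s) := by
  obtain ⟨N, h, a, hh, hφ⟩ := hφ f
  have hpoly : ∀ i, ∃ q : K[X], ∀ s : K, h i (Multiplicative.ofAdd s) = q.eval s := by
    intro i
    have hi := hh i
    rw [gaFunctions, Algebra.adjoin_singleton_eq_range_aeval] at hi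
    obtain ⟨q, hq⟩ := hi
    refine ⟨q, fun s => ?_⟩
    rw [← hq]
    change Pi.evalAlgHom K (fun _ => K) (Multiplicative.ofAdd s) (aeval _ q) = _
    rw [← aeval_algHom_apply]
    rfl
  choose q hq using hpoly
  refine ⟨∑ i, (q i).map (algebraMap K A) * C (a i), fun s => ?_⟩
  rw [hφ, eval_finsetSum]
  refine Finset.sum_congr rfl fun i _ => ?_
  rw [eval_mul, eval_C, eval_map_algebraMap, aeval_algebraMap_apply, hq, ← Algebra.smul_def,
    coe_aeval_eq_eval]

/-- A nontrivial action of the additive group yields a nonzero locally nilpotent derivation. -/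
theorem exists_derivation_of_action [CharZero K] [IsDomain A]
    (hφ : IsAlgebraicAction (gaFunctions K) φ) (hne : φ ≠ 1) :
    ∃ D : Derivation K A A, D ≠ 0 ∧ ∀ a, ∃ k, D^[k] a = 0 := by
  choose P hP using hφ.exists_polynomial
  have hadd : ∀ a b, P (a + b) = P a + P b := fun a b =>
    polynomial_eq_of_forall_eval (K := K) fun s => by rw [eval_add, ← hP, ← hP, ← hP, map_add]
  have hmul : ∀ a b, P (a * b) = P a * P b := fun a b =>
    polynomial_eq_of_forall_eval (K := K) fun s => by rw [eval_mul, ← hP, ← hP, ← hP, map_mul]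
  have hsmul : ∀ (c : K) a, P (c • a) = c • P a := fun c a =>
    polynomial_eq_of_forall_eval (K := K) fun s => by rw [eval_smul, ← hP, ← hP, map_smul]
  have hzero : ∀ a, (P a).coeff 0 = a := fun a => by
    have := hP a 0
    rw [(algebraMap K A).map_zero, ← coeff_zero_eq_eval_zero, ofAdd_zero, map_one] at this
    exact this.symm
  let D : Derivation K A A := Derivation.mk'
    { toFun := fun a => (P a).coeff 1
      map_add' := fun a b => by rw [hadd, coeff_add]
      map_smul' := fun c a => by rw [hsmul, coeff_smul, RingHom.id_apply] }
    fun a b => by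
      change (P (a * b)).coeff 1 = a * (P b).coeff 1 + b * (P a).coeff 1
      rw [hmul, coeff_mul, Finset.Nat.antidiagonal_succ]
      simp [hzero]
      ring
  -- Compare the coefficients of t in φ_s(φ_t a) = φ_(s+t) a. Differentiation lowers degrees, so `D`
  -- is locally nilpotent.
  have hD : ∀ a, P (D a) = derivative (P a) := by
    intro a
    refine polynomial_eq_of_forall_eval (K := K) fun s => ?_
    have h : (P a).map (φ (Multiplicative.ofAdd s) : A →+* A) =
        taylor (algebraMap K A s) (P a) := by
      refine polynomial_eq_of_forall_eval (K := K) fun t => ?_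
      rw [taylor_eval, ← map_add, ← hP]
      have h1 : algebraMap K A t = (φ (Multiplicative.ofAdd s) : A →+* A) (algebraMap K A t) := by
        simp
      rw [h1, eval_map_apply, ← hP, add_comm, ofAdd_add, map_mul]
      rfl
    have h2 := congrArg (fun p => coeff p 1) h
    simp only [coeff_map, taylor_coeff_one] at h2
    rw [← h2, ← hP]
    rfl
  refine ⟨D, fun h0 => hne ?_, fun a => ?_⟩
  · ext s a
    have h1 : derivative (P a) = 0 := by
      rw [← hD, h0, Derivation.zero_apply]
      simpa using hsmul 0 (0 : A)
    have : CharZero A := charZero_of_injective_algebraMap (algebraMap K A).injective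
    have h2 := derivative_eq_zero.1 h1
    rw [natDegree_eq_zero] at h2
    obtain ⟨c, hc⟩ := h2
    have h3 := hP a s
    have h4 := hzero a
    rw [← hc, coeff_C_zero] at h4
    rw [← hc, eval_C, h4] at h3
    exact h3
  · refine ⟨(P a).natDegree + 1, ?_⟩
    have h : P (D^[(P a).natDegree + 1] a) = derivative^[(P a).natDegree + 1] (P a) :=
      Function.Semiconj.iterate_right (f := P) (ga := D) (gb := derivative) hD _ a
    rw [← hzero (D^[(P a).natDegree + 1] a), h, iterate_derivative_eq_zero (Nat.lt_succ_self _),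
      coeff_zero]

/-- A function that vanishes nowhere along an orbit of the additive group is constant on it. -/
theorem IsAlgebraicAction.apply_eq_of_forall_ne_zero [IsAlgClosed K]
    (hφ : IsAlgebraicAction (gaFunctions K) φ) (y : A →ₐ[K] K) (f : A)
    (h : ∀ s, y (φ s f) ≠ 0) (s : Multiplicative K) : y (φ s f) = y f := by
  obtain ⟨p, hp⟩ := hφ.exists_polynomial f
  have hev : ∀ s : K, y (φ (Multiplicative.ofAdd s) f) = (p.map (y : A →+* K)).eval s := by
    intro s
    have h1 : s = (y : A →+* K) (algebraMap K A s) := by simp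
    conv_rhs => rw [h1]
    rw [eval_map_apply, hp]
    rfl
  have hdeg : (p.map (y : A →+* K)).degree = 0 ∨ p.map (y : A →+* K) = 0 := by
    by_contra! hcon
    obtain ⟨s, hs⟩ := IsAlgClosed.exists_root _ hcon.1
    exact h _ ((hev s).trans hs)
  have hC : ∃ c, p.map (y : A →+* K) = C c := by
    rcases hdeg with h0 | h0
    · exact ⟨_, eq_C_of_degree_eq_zero h0⟩
    · exact ⟨0, by rw [h0, C_0]⟩
  obtain ⟨c, hc⟩ := hC
  have h0 := hev 0
  rw [ofAdd_zero, map_one, hc, eval_C] at h0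
  have h1 := hev s.toAdd
  rw [hc, eval_C] at h1
  exact h1.trans h0.symm

end Coaction

end AdditiveGroup

/-! ### Characters of the torus. -/

section Characters

variable {K : Type*} [Field K] {n : ℕ}

/-- The character `χ^m` as a monoid homomorphism to the field. -/
def characterHom (K : Type*) [Field K] (m : Fin n → ℤ) : (Fin n → Kˣ) →* K :=
  (Units.coeHom K).comp
    { toFun := character m
      map_one' := by simp [character]
      map_mul' := fun s t => by simp [character, mul_zpow, Finset.prod_mul_distrib] }

@[simp] theorem characterHom_apply (m : Fin n → ℤ) (t : Fin n → Kˣ) :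
    characterHom K m t = (character m t : K) := rfl

theorem character_zero (t : Fin n → Kˣ) : character 0 t = 1 := by simp [character]

theorem character_add (m m' : Fin n → ℤ) (t : Fin n → Kˣ) :
    character (m + m') t = character m t * character m' t := by
  simp [character, zpow_add, Finset.prod_mul_distrib]

theorem character_single (i : Fin n) (k : ℤ) (t : Fin n → Kˣ) :
    character (Pi.single i k) t = t i ^ k := by
  rw [character, Finset.prod_eq_single i]
  · simp
  · intro j _ hj
    simp [Pi.single_eq_of_ne hj]
  · simp

/-- The element 2 has infinite order in characteristic zero, so a torus point with a single
coordinate 2 and the others 1 reads off one exponent. -/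
theorem characterHom_injective [CharZero K] :
    Function.Injective (characterHom K : (Fin n → ℤ) → (Fin n → Kˣ) →* K) := by
  intro m m' h
  ext i
  have h2 : (2 : K) ≠ 0 := two_ne_zero
  have key : ∀ k : Fin n → ℤ, (character k (Pi.mulSingle i (Units.mk0 2 h2)) : K) = 2 ^ k i := by
    intro k
    rw [character, Finset.prod_eq_single i]
    · simp
    · intro j _ hj
      simp [Pi.mulSingle_eq_of_ne hj]
    · simp
  have h1 := DFunLike.congr_fun h (Pi.mulSingle i (Units.mk0 2 h2))
  simp only [characterHom_apply, key] at h1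
  have h3 : (((2 : ℚ) ^ m i : ℚ) : K) = (((2 : ℚ) ^ m' i : ℚ) : K) := by push_cast; exact h1
  exact zpow_right_injective₀ (by norm_num) (by norm_num) (Rat.cast_injective h3)

theorem linearIndependent_characterHom [CharZero K] :
    LinearIndependent K fun m : Fin n → ℤ => (characterHom K m : (Fin n → Kˣ) → K) :=
  (linearIndependent_monoidHom (Fin n → Kˣ) K).comp _ characterHom_injective

/-- Characters are linearly independent also with vector coefficients. -/
theorem eq_zero_of_sum_character_smul [CharZero K] {V : Type*} [AddCommGroup V] [Module K V]
    (S : Finset (Fin n → ℤ)) (v : (Fin n → ℤ) → V)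
    (h : ∀ t : Fin n → Kˣ, ∑ m ∈ S, (character m t : K) • v m = 0) : ∀ m ∈ S, v m = 0 := by
  intro m hm
  refine (Module.forall_dual_apply_eq_zero_iff K (v m)).1 fun f => ?_
  have key : ∑ m ∈ S, f (v m) • (characterHom K m : (Fin n → Kˣ) → K) = 0 := by
    ext t
    have h1 := congrArg f (h t)
    rw [map_sum, map_zero] at h1
    rw [Finset.sum_apply, Pi.zero_apply, ← h1]
    refine Finset.sum_congr rfl fun m _ => ?_
    rw [map_smul, Pi.smul_apply, smul_eq_mul, smul_eq_mul, mul_comm, characterHom_apply]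
  have hli := linearIndependent_characterHom (K := K) (n := n)
  rw [linearIndependent_iff'] at hli
  exact hli S (fun m => f (v m)) key m hm

/-- The characters form a monoid containing the algebra generators, so they span. -/
theorem exists_finsupp_of_mem_torusFunctions {h : (Fin n → Kˣ) → K} (hh : h ∈ torusFunctions K n) :
    ∃ c : (Fin n → ℤ) →₀ K, ∀ t, h t = c.sum fun m r => r * (character m t : K) := by
  have hle : Submonoid.closure (Set.range (fun i (t : Fin n → Kˣ) => (t i : K)) ∪
      Set.range (fun i t => ((t i)⁻¹ : K))) ≤
      (⟨⟨Set.range fun m : Fin n → ℤ => (characterHom K m : (Fin n → Kˣ) → K), by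
        rintro _ _ ⟨m, rfl⟩ ⟨m', rfl⟩
        exact ⟨m + m', by ext t; simp [character_add]⟩⟩,
        ⟨0, by ext t; simp [character_zero]⟩⟩ : Submonoid ((Fin n → Kˣ) → K)) := by
    rw [Submonoid.closure_le]
    rintro _ (⟨i, rfl⟩ | ⟨i, rfl⟩)
    · exact ⟨Pi.single i 1, by ext t; simp [character_single]⟩
    · exact ⟨Pi.single i (-1), by ext t; simp [character_single]⟩
  rw [torusFunctions, ← Subalgebra.mem_toSubmodule, Algebra.adjoin_eq_span] at hh
  have h1 := Submodule.span_mono (R := K) (SetLike.coe_subset_coe.2 hle) hh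
  obtain ⟨c, hc⟩ := (Finsupp.mem_span_range_iff_exists_finsupp (R := K)
    (v := fun m : Fin n → ℤ => (characterHom K m : (Fin n → Kˣ) → K))).1 h1
  refine ⟨c, fun t => ?_⟩
  rw [← hc, Finsupp.sum, Finsupp.sum, Finset.sum_apply]
  rfl

end Characters

/-! ### The basis of semi-invariants. -/

section WeightBasis

variable {K : Type*} [Field K] {A : Type*} [CommRing A] [Algebra K A] {n : ℕ}
variable {φ : (Fin n → Kˣ) →* (A ≃ₐ[K] A)}

/-- Every regular function is a finite sum of semi-invariants. -/
theorem IsAlgebraicAction.exists_weight_decomposition [CharZero K]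
    (hφ : IsAlgebraicAction (torusFunctions K n) φ) (f : A) :
    ∃ (S : Finset (Fin n → ℤ)) (g : (Fin n → ℤ) → A),
      (∀ m ∈ S, ∀ t, φ t (g m) = (character m t : K) • g m) ∧ f = ∑ m ∈ S, g m := by
  classical
  obtain ⟨N, h, a, hh, hf⟩ := hφ f
  choose c hc using fun i => exists_finsupp_of_mem_torusFunctions (hh i)
  let S := Finset.univ.biUnion fun i => (c i).support
  let g : (Fin n → ℤ) → A := fun m => ∑ i, c i m • a i
  have hg : ∀ t, φ t f = ∑ m ∈ S, (character m t : K) • g m := by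
    intro t
    have h1 : ∀ i, h i t = ∑ m ∈ S, c i m * (character m t : K) := by
      intro i
      rw [hc, Finsupp.sum]
      refine Finset.sum_subset (Finset.subset_biUnion_of_mem (fun i => (c i).support)
        (Finset.mem_univ i)) fun m _ hm => ?_
      rw [Finsupp.notMem_support_iff.1 hm, zero_mul]
    simp only [hf, h1, g, Finset.smul_sum, Finset.sum_smul, smul_smul]
    rw [Finset.sum_comm]
    simp only [mul_comm]
  -- Comparing the coefficients of the characters of t in φ_s(φ_t f) = φ_(st) f shows that each `g
  -- m` is semi-invariant; t = 1 recovers f.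
  refine ⟨S, g, fun m hm s => ?_, ?_⟩
  · refine sub_eq_zero.1 (eq_zero_of_sum_character_smul (K := K) S
      (fun m => φ s (g m) - (character m s : K) • g m) (fun t => ?_) m hm)
    have h1 : φ s (φ t f) = φ (s * t) f := by rw [map_mul]; rfl
    rw [hg, hg, map_sum] at h1
    simp only [smul_sub, Finset.sum_sub_distrib, sub_eq_zero]
    convert h1 using 2 with m _ m _
    · rw [map_smul]
    · rw [smul_smul, ← characterHom_apply, ← characterHom_apply, ← characterHom_apply, map_mul,
        mul_comm]
  · have h1 := hg 1
    simp only [map_one, ← characterHom_apply, one_smul] at h1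
    exact h1

/-- On an irreducible variety the open orbit is dense: it contains the nonvanishing set of some g ≠
0, and g f would be nonzero at some point. -/
theorem eq_zero_of_forall_mem_orbit [IsAlgClosed K] [IsDomain A] [Algebra.FiniteType K A]
    {x₀ : A →ₐ[K] K} (hx₀ : IsZariskiOpen (orbit φ x₀)) {f : A}
    (hf : ∀ y ∈ orbit φ x₀, y f = 0) : f = 0 := by
  have hmem : x₀ ∈ orbit φ x₀ := ⟨1, fun f => by rw [map_one]; rfl⟩
  obtain ⟨g, hg0, hg⟩ := hx₀.exists_ne_zero hmem
  by_contra hf0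
  obtain ⟨y, hy⟩ := exists_point_ne_zero (K := K) (mul_ne_zero hg0 hf0)
  rw [map_mul] at hy
  exact right_ne_zero_of_mul hy (hf y (hg y (left_ne_zero_of_mul hy)))

/-- If the torus has an open orbit, then suitably normalised semi-invariants form a basis of the
algebra of regular functions, which is thus the algebra of the weight monoid. -/
theorem exists_weight_basis [IsAlgClosed K] [CharZero K] [IsDomain A] [Algebra.FiniteType K A]
    (hφ : IsAlgebraicAction (torusFunctions K n) φ) {x₀ : A →ₐ[K] K}
    (hx₀ : IsZariskiOpen (orbit φ x₀)) :
    ∃ b : Module.Basis (weightMonoid φ) K A, b 0 = 1 ∧ (∀ p q, b (p + q) = b p * b q) ∧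
      (∀ p t, φ t (b p) = (character (p : Fin n → ℤ) t : K) • b p) ∧ ∀ p, x₀ (b p) = 1 := by
  -- A semi-invariant of given weight is determined by its value at `x₀`. Normalising that value to
  -- 1 therefore makes the basis unique and multiplicative.
  have hzero : ∀ (m : Fin n → ℤ) (f : A), (∀ t, φ t f = (character m t : K) • f) → x₀ f = 0 →
      f = 0 := by
    intro m f hf h0
    refine eq_zero_of_forall_mem_orbit hx₀ ?_
    rintro y ⟨t, hy⟩
    rw [hy, hf, map_smul, h0, smul_zero]
  have hex : ∀ p : weightMonoid φ, ∃ f : A,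
      (∀ t, φ t f = (character (p : Fin n → ℤ) t : K) • f) ∧ x₀ f = 1 := by
    rintro ⟨m, f, hf0, hf⟩
    have h0 : x₀ f ≠ 0 := fun h => hf0 (hzero m f hf h)
    refine ⟨(x₀ f)⁻¹ • f, fun t => ?_, ?_⟩
    · rw [map_smul, hf, smul_comm]
    · rw [map_smul, smul_eq_mul, inv_mul_cancel₀ h0]
  choose e he he1 using hex
  have huniq : ∀ (p : weightMonoid φ) (f : A),
      (∀ t, φ t f = (character (p : Fin n → ℤ) t : K) • f) → f = x₀ f • e p := by
    intro p f hf
    refine sub_eq_zero.1 (hzero p _ (fun t => ?_) ?_)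
    · rw [map_sub, map_smul, hf, he, smul_sub, smul_comm]
    · rw [map_sub, map_smul, he1, smul_eq_mul, mul_one, sub_self]
  have hne : ∀ p, e p ≠ 0 := fun p h => by simpa [h] using he1 p
  have hli : LinearIndependent K e := by
    classical
    rw [linearIndependent_iff']
    intro S c hc p hp
    let v : (Fin n → ℤ) → A := fun m =>
      if hm : m ∈ weightMonoid φ then c ⟨m, hm⟩ • e ⟨m, hm⟩ else 0
    have hv : ∀ p : weightMonoid φ, v p = c p • e p := fun p => by simp [v]
    have h1 := eq_zero_of_sum_character_smul (K := K) (S.image Subtype.val) v (fun t => by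
      rw [Finset.sum_image (fun _ _ _ _ h => Subtype.ext h)]
      have h2 := congrArg (φ t) hc
      rw [map_sum, map_zero] at h2
      rw [← h2]
      refine Finset.sum_congr rfl fun q _ => ?_
      rw [hv, map_smul, he, smul_comm]) p (Finset.mem_image_of_mem _ hp)
    rw [hv] at h1
    exact (smul_eq_zero.1 h1).resolve_right (hne p)
  have hsp : ⊤ ≤ Submodule.span K (Set.range e) := by
    intro f _
    obtain ⟨S, g, hg, rfl⟩ := hφ.exists_weight_decomposition f
    refine sum_mem fun m hm => ?_
    by_cases h0 : g m = 0
    · rw [h0]; exact zero_mem _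
    · rw [huniq ⟨m, g m, h0, hg m hm⟩ (g m) (hg m hm)]
      exact Submodule.smul_mem _ _ (Submodule.subset_span ⟨_, rfl⟩)
  refine ⟨Module.Basis.mk hli hsp, ?_, fun p q => ?_, fun p t => ?_, fun p => ?_⟩
  · rw [Module.Basis.mk_apply, huniq 0 1 (fun t => by
      rw [map_one, AddSubmonoid.coe_zero, character_zero, Units.val_one, one_smul]), map_one,
      one_smul]
  · simp only [Module.Basis.mk_apply]
    rw [huniq (p + q) (e p * e q) (fun t => by
      rw [map_mul, he, he, AddSubmonoid.coe_add, character_add, Units.val_mul,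
        smul_mul_smul_comm]), map_mul, he1, he1, one_mul, one_smul]
  · simp only [Module.Basis.mk_apply, he]
  · simp only [Module.Basis.mk_apply, he1]

end WeightBasis

/-! ### Extending homomorphisms from the weight monoid to the lattice. -/

section Extension

theorem mem_closure_iff_exists_sub {M : Type*} [AddCommGroup M] (P : AddSubmonoid M) {v : M} :
    v ∈ AddSubgroup.closure (P : Set M) ↔ ∃ u ∈ P, ∃ w ∈ P, v = u - w := by
  constructor
  · intro h
    induction h using AddSubgroup.closure_induction with
    | mem x hx => exact ⟨x, hx, 0, zero_mem _, (sub_zero x).symm⟩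
    | zero => exact ⟨0, zero_mem _, 0, zero_mem _, (sub_zero 0).symm⟩
    | add x y _ _ hx hy =>
      obtain ⟨u, hu, w, hw, rfl⟩ := hx
      obtain ⟨u', hu', w', hw', rfl⟩ := hy
      exact ⟨u + u', add_mem hu hu', w + w', add_mem hw hw', by abel⟩
    | neg x _ hx =>
      obtain ⟨u, hu, w, hw, rfl⟩ := hx
      exact ⟨w, hw, u, hu, by abel⟩
  · rintro ⟨u, hu, w, hw, rfl⟩
    exact sub_mem (AddSubgroup.subset_closure hu) (AddSubgroup.subset_closure hw)

/-- A homomorphism from a submonoid to a group extends to the subgroup it generates. -/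
theorem exists_extension_closure {M G : Type*} [AddCommGroup M] [AddCommGroup G]
    (P : AddSubmonoid M) (g : P →+ G) :
    ∃ h : AddSubgroup.closure (P : Set M) →+ G,
      ∀ p : P, h ⟨p, AddSubgroup.subset_closure p.2⟩ = g p := by
  have hex : ∀ v : AddSubgroup.closure (P : Set M), ∃ u w : P, (v : M) = u - w := by
    intro v
    obtain ⟨u, hu, w, hw, h⟩ := (mem_closure_iff_exists_sub P).1 v.2
    exact ⟨⟨u, hu⟩, ⟨w, hw⟩, h⟩
  choose u w huw using hex
  have hwd : ∀ p q p' q' : P, (p : M) - q = p' - q' → g p - g q = g p' - g q' := by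
    intro p q p' q' h
    rw [sub_eq_sub_iff_add_eq_add] at h ⊢
    rw [← map_add, ← map_add]
    congr 1
    exact Subtype.ext h
  refine ⟨AddMonoidHom.mk' (fun v => g (u v) - g (w v)) fun v v' => ?_, fun p => ?_⟩
  · rw [hwd (u (v + v')) (w (v + v')) (u v + u v') (w v + w v'), map_add, map_add]
    · abel
    · rw [← huw, AddSubgroup.coe_add, huw v, huw v', AddSubmonoid.coe_add, AddSubmonoid.coe_add]
      abel
  · have h := hwd (u ⟨p, AddSubgroup.subset_closure p.2⟩) (w ⟨p, AddSubgroup.subset_closure p.2⟩)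
      p 0 (by rw [← huw, AddSubmonoid.coe_zero, sub_zero])
    rw [map_zero, sub_zero] at h
    exact h

variable {K : Type*} [Field K] {n : ℕ}

/-- Every homomorphism from the character lattice to `Kˣ` is evaluation at a point of the torus. -/
theorem character_eq_of_hom (h : (Fin n → ℤ) →+ Additive Kˣ) (m : Fin n → ℤ) :
    character m (fun i => (h (Pi.single i 1)).toMul) = (h m).toMul := by
  have h1 : m = ∑ i, m i • Pi.single i (1 : ℤ) := by
    ext j
    simp [Finset.sum_apply, Pi.single_apply]
  conv_rhs => rw [h1, map_sum]
  rw [toMul_sum, character]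
  refine Finset.prod_congr rfl fun i _ => ?_
  rw [map_zsmul, toMul_zsmul]

/-- Roots exist in `K`, so `Kˣ` is divisible and hence injective. This permits extension to the
whole lattice even when the weights do not generate it, as for a noneffective action. -/
theorem baer_units [IsAlgClosed K] : Module.Baer ℤ (Additive Kˣ) := by
  have hsurj : ∀ {k : ℕ}, k ≠ 0 → Function.Surjective fun a : Additive Kˣ => k • a := by
    intro k hk a
    obtain ⟨z, hz⟩ := IsAlgClosed.exists_pow_nat_eq (a.toMul : K) (Nat.pos_of_ne_zero hk)
    have hz0 : z ≠ 0 := by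
      rintro rfl
      rw [zero_pow hk] at hz
      exact a.toMul.ne_zero hz.symm
    refine ⟨Additive.ofMul (Units.mk0 z hz0), ?_⟩
    apply Additive.toMul.injective
    ext
    simpa using hz
  let : DivisibleBy (Additive Kˣ) ℕ := divisibleByOfSMulRightSurj _ _ hsurj
  let : DivisibleBy (Additive Kˣ) ℤ := AddGroup.divisibleByIntOfDivisibleByNat _
  exact Module.Baer.of_divisible _

/-- A maximal proper subgroup containing `N` has a finite simple cyclic quotient, and `K` has enough
roots of unity to give it a nontrivial character. -/
theorem exists_hom_ne_zero_of_ne_top [IsAlgClosed K] [CharZero K] {N : AddSubgroup (Fin n → ℤ)}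
    (hN : N ≠ ⊤) : ∃ h : (Fin n → ℤ) →+ Additive Kˣ, (∀ v ∈ N, h v = 0) ∧ h ≠ 0 := by
  obtain ⟨W, hW, hle⟩ := (eq_top_or_exists_le_coatom (AddSubgroup.toIntSubmodule N)).resolve_left
    (by rwa [← map_top AddSubgroup.toIntSubmodule, (OrderIso.injective _).eq_iff])
  have : IsSimpleModule ℤ ((Fin n → ℤ) ⧸ W) := isSimpleModule_iff_isCoatom.2 hW
  obtain ⟨I, hI, ⟨e⟩⟩ := isSimpleModule_iff_quot_maximal.1 this
  have hfin : Finite (ℤ ⧸ I) := Ideal.finiteQuotientOfFreeOfNeBot I fun h =>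
    Int.not_isField ((Ring.isField_iff_maximal_bot).2 (h ▸ hI))
  have : Finite (Multiplicative (ℤ ⧸ I)) := hfin
  have : Nontrivial (ℤ ⧸ I) := Ideal.Quotient.nontrivial_iff.2 hI.ne_top
  obtain ⟨a, ha⟩ := exists_ne (1 : Multiplicative (ℤ ⧸ I))
  have : NeZero ((Monoid.exponent (Multiplicative (ℤ ⧸ I)) : ℕ) : K) :=
    ⟨Nat.cast_ne_zero.2 Monoid.exponent_ne_zero_of_finite⟩
  obtain ⟨ψ, hψ⟩ :=
    CommGroup.exists_apply_ne_one_of_hasEnoughRootsOfUnity (Multiplicative (ℤ ⧸ I)) K ha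
  let h : (Fin n → ℤ) →+ Additive Kˣ := (MonoidHom.toAdditiveRight ψ).comp
    ((e : ((Fin n → ℤ) ⧸ W) →+ ℤ ⧸ I).comp (W.mkQ : (Fin n → ℤ) →+ _))
  refine ⟨h, fun v hv => ?_, fun h0 => hψ ?_⟩
  · have h1 : W.mkQ v = 0 := by simpa using hle hv
    change MonoidHom.toAdditiveRight ψ (e (W.mkQ v)) = 0
    rw [h1, map_zero, map_zero]
  · obtain ⟨v, hv⟩ := W.mkQ_surjective (e.symm a.toAdd)
    have h1 : h v = 0 := by rw [h0]; rfl
    have h2 : h v = MonoidHom.toAdditiveRight ψ a.toAdd := by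
      change MonoidHom.toAdditiveRight ψ (e (W.mkQ v)) = _
      rw [hv, LinearEquiv.apply_symm_apply]
    rw [h1] at h2
    exact h2.symm

end Extension

/-! ### The open orbit, effectiveness and finite generation. -/

section Orbit

variable {K : Type*} [Field K] {A : Type*} [CommRing A] [Algebra K A] {n : ℕ}
variable {φ : (Fin n → Kˣ) →* (A ≃ₐ[K] A)}

/-- The open orbit is the set of points where no semi-invariant vanishes. -/
theorem mem_orbit_iff_forall_ne_zero [IsAlgClosed K] [IsDomain A] {x₀ : A →ₐ[K] K}
    (b : Module.Basis (weightMonoid φ) K A) (hb0 : b 0 = 1) (hbm : ∀ p q, b (p + q) = b p * b q)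
    (hbφ : ∀ p t, φ t (b p) = (character (p : Fin n → ℤ) t : K) • b p) (hbx : ∀ p, x₀ (b p) = 1)
    (y : A →ₐ[K] K) : y ∈ orbit φ x₀ ↔ ∀ p, y (b p) ≠ 0 := by
  constructor
  · rintro ⟨t, ht⟩ p
    rw [ht, hbφ, map_smul, hbx, smul_eq_mul, mul_one]
    exact Units.ne_zero _
  · intro hy
    let g : weightMonoid φ →+ Additive Kˣ :=
      { toFun := fun p => Additive.ofMul (Units.mk0 (y (b p)) (hy p))
        map_zero' := by
          apply Additive.toMul.injective
          ext
          simp [hb0]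
        map_add' := fun p q => by
          apply Additive.toMul.injective
          ext
          simp [hbm] }
    -- The values of y on the basis define a homomorphism to `Kˣ`; an extension of it to the lattice
    -- is a torus element carrying `x₀` to y.
    obtain ⟨g', hg'⟩ := exists_extension_closure (weightMonoid φ) g
    obtain ⟨h, hh⟩ := baer_units.extension_property_addMonoidHom
      (AddSubgroup.closure (weightMonoid φ : Set (Fin n → ℤ))).subtype
      (AddSubgroup.subtype_injective _) g'
    refine ⟨fun i => (h (Pi.single i 1)).toMul, fun f => ?_⟩
    have hlin : y.toLinearMap =
        x₀.toLinearMap ∘ₗ (φ fun i => (h (Pi.single i 1)).toMul).toLinearMap := by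
      refine b.ext fun p => ?_
      have h1 : h p = g p := by
        rw [← hg', ← hh]
        rfl
      change y (b p) = x₀ (φ _ (b p))
      rw [hbφ, map_smul, hbx, smul_eq_mul, mul_one, character_eq_of_hom, h1]
      rfl
    exact LinearMap.congr_fun hlin f

/-- If the torus acts effectively, then the weights generate the character lattice. -/
theorem closure_weightMonoid_eq_top [IsAlgClosed K] [CharZero K] [IsDomain A]
    (b : Module.Basis (weightMonoid φ) K A)
    (hbφ : ∀ p t, φ t (b p) = (character (p : Fin n → ℤ) t : K) • b p)
    (hinj : Function.Injective φ) :
    AddSubgroup.closure (weightMonoid φ : Set (Fin n → ℤ)) = ⊤ := by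
  by_contra hne
  obtain ⟨h, hh, hh0⟩ := exists_hom_ne_zero_of_ne_top (K := K) hne
  have ht : φ (fun i => (h (Pi.single i 1)).toMul) = φ 1 := by
    have hlin : (φ fun i => (h (Pi.single i 1)).toMul).toLinearMap =
        (φ 1).toLinearMap := by
      refine b.ext fun p => ?_
      change φ _ (b p) = φ 1 (b p)
      rw [hbφ, character_eq_of_hom, hh _ (AddSubgroup.subset_closure p.2), map_one]
      simp
    ext f
    exact LinearMap.congr_fun hlin f
  refine hh0 (AddMonoidHom.ext fun m => ?_)
  have h1 := character_eq_of_hom h m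
  rw [hinj ht] at h1
  apply Additive.toMul.injective
  rw [← h1]
  simp [character]

/-- The multiplicative basis identifies `A` with the monoid algebra of `P`, and a monoid whose
algebra is of finite type is finitely generated. -/
theorem fg_of_basis [Algebra.FiniteType K A] {P : AddSubmonoid (Fin n → ℤ)}
    (b : Module.Basis P K A) (hb0 : b 0 = 1) (hbm : ∀ p q, b (p + q) = b p * b q) : P.FG := by
  let F : AddMonoidAlgebra K P →ₐ[K] A := AddMonoidAlgebra.lift K A P
    { toFun := fun p => b p.toAdd
      map_one' := hb0
      map_mul' := fun p q => hbm _ _ }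
  have hF : ∀ f, F f = b.repr.symm (AddMonoidAlgebra.coeffEquiv f) := by
    intro f
    rw [Module.Basis.repr_symm_apply]
    exact AddMonoidAlgebra.lift_apply _ f
  have hbij : Function.Bijective F := by
    have : (F : AddMonoidAlgebra K P → A) = b.repr.symm ∘ AddMonoidAlgebra.coeffEquiv := funext hF
    rw [this]
    exact b.repr.symm.bijective.comp AddMonoidAlgebra.coeffEquiv.bijective
  have : Algebra.FiniteType K (AddMonoidAlgebra K P) :=
    ‹Algebra.FiniteType K A›.equiv (AlgEquiv.ofBijective F hbij).symm
  exact (AddMonoid.fg_iff_addSubmonoid_fg P).1 (AddMonoidAlgebra.fg_of_finiteType (R := K))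

end Orbit

/-! ### Homogeneous derivations. -/

section Graded

variable {K : Type*} [Field K] {A : Type*} [CommRing A] [Algebra K A] {n : ℕ}
variable {P : AddSubmonoid (Fin n → ℤ)} (b : Module.Basis P K A)

theorem basis_induction {p : A → Prop} (hb : ∀ q, p (b q)) (h0 : p 0)
    (hadd : ∀ x y, p x → p y → p (x + y)) (hsmul : ∀ (c : K) x, p x → p (c • x)) (a : A) : p a :=
  Submodule.span_induction (p := fun x _ => p x) (by rintro _ ⟨q, rfl⟩; exact hb q) h0
    (fun x y _ _ => hadd x y) (fun c x _ => hsmul c x) (b.mem_span a)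

open Classical in
/-- The coefficient of a regular function at a point of the character lattice; it is zero at the
points that are not weights. -/
noncomputable def weightCoeff (v : Fin n → ℤ) : A →ₗ[K] K :=
  if h : v ∈ P then b.coord ⟨v, h⟩ else 0

theorem weightCoeff_of_mem {v : Fin n → ℤ} (hv : v ∈ P) (a : A) :
    weightCoeff b v a = b.repr a ⟨v, hv⟩ := by
  rw [weightCoeff, dif_pos hv, Module.Basis.coord_apply]

theorem weightCoeff_coe (p : P) (a : A) : weightCoeff b (p : Fin n → ℤ) a = b.repr a p :=
  weightCoeff_of_mem b p.2 a

theorem mem_of_weightCoeff_ne_zero {v : Fin n → ℤ} {a : A} (h : weightCoeff b v a ≠ 0) : v ∈ P := by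
  by_contra hv
  rw [weightCoeff, dif_neg hv] at h
  exact h rfl

open Classical in
theorem weightCoeff_basis (v : Fin n → ℤ) (q : P) :
    weightCoeff b v (b q) = if v = q then 1 else 0 := by
  by_cases hv : v ∈ P
  · rw [weightCoeff_of_mem b hv, Module.Basis.repr_self, Finsupp.single_apply]
    refine if_congr ?_ rfl rfl
    rw [Subtype.ext_iff, eq_comm]
  · rw [weightCoeff, dif_neg hv, if_neg]
    · rfl
    · rintro rfl
      exact hv q.2

theorem eq_zero_of_forall_weightCoeff {a : A} (h : ∀ v, weightCoeff b v a = 0) : a = 0 := by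
  apply b.repr.injective
  ext p
  rw [← weightCoeff_coe, h, map_zero, Finsupp.zero_apply]

variable {b}

/-- Cancellation in the lattice keeps this valid when `v` is not a weight, which is why coefficients
are extended by zero. It turns the Leibniz rule into additivity of `degreeComponent`. -/
theorem weightCoeff_mul (hbm : ∀ p q, b (p + q) = b p * b q) (p : P) (v : Fin n → ℤ) (a : A) :
    weightCoeff b (p + v) (b p * a) = weightCoeff b v a := by
  induction a using basis_induction b with
  | hb q =>
    rw [← hbm, weightCoeff_basis, weightCoeff_basis, AddSubmonoid.coe_add]
    simp only [add_right_inj]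
  | h0 => rw [mul_zero, map_zero, map_zero]
  | hadd x y hx hy => rw [mul_add, map_add, map_add, hx, hy]
  | hsmul c x hx => rw [mul_smul_comm, map_smul, map_smul, hx]

/-- The homogeneous component of degree `e` of a derivation. -/
noncomputable def degreeComponent (hb0 : b 0 = 1) (hbm : ∀ p q, b (p + q) = b p * b q)
    (D : Derivation K A A) (e : Fin n → ℤ) : P →+ K where
  toFun p := weightCoeff b (p + e) (D (b p))
  map_zero' := by rw [hb0, D.map_one_eq_zero, map_zero]
  map_add' p q := by
    rw [hbm, D.leibniz, map_add, smul_eq_mul, smul_eq_mul, AddSubmonoid.coe_add, add_assoc,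
      weightCoeff_mul hbm, add_left_comm, weightCoeff_mul hbm, add_comm]

theorem degreeComponent_apply (hb0 : b 0 = 1) (hbm : ∀ p q, b (p + q) = b p * b q)
    (D : Derivation K A A) (e : Fin n → ℤ) (p : P) :
    degreeComponent hb0 hbm D e p = weightCoeff b (p + e) (D (b p)) := rfl

section Homogeneous

variable (b) in
open Classical in
/-- The basis element of weight `v`, or zero if `v` is not a weight. -/
noncomputable def weightVector (v : Fin n → ℤ) : A :=
  if h : v ∈ P then b ⟨v, h⟩ else 0

theorem weightVector_of_mem {v : Fin n → ℤ} (hv : v ∈ P) : weightVector b v = b ⟨v, hv⟩ := by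
  rw [weightVector, dif_pos hv]

theorem weightVector_of_notMem {v : Fin n → ℤ} (hv : v ∉ P) : weightVector b v = 0 := by
  rw [weightVector, dif_neg hv]

variable (ℓ : P →+ K) (e : Fin n → ℤ)

/-- The homogeneous derivation `χ^p ↦ ℓ(p) χ^(p + e)`. -/
noncomputable def homogeneousDerivation (hbm : ∀ p q, b (p + q) = b p * b q)
    (h : ∀ p : P, ℓ p ≠ 0 → (p : Fin n → ℤ) + e ∈ P) : Derivation K A A :=
  Derivation.mk' (b.constr K fun p => ℓ p • weightVector b (p + e)) fun x y => by
    have hmul : ∀ p q : P, b q * (ℓ p • weightVector b (p + e)) =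
        ℓ p • weightVector b (p + q + e) := by
      intro p q
      -- If ℓ(p) = 0, then p + e may lie outside `P` while p + q + e lies inside; the zero
      -- coefficient makes both sides agree.
      by_cases hp : ℓ p = 0
      · rw [hp, zero_smul, zero_smul, mul_zero]
      · have h1 := h p hp
        have h2 : (p : Fin n → ℤ) + q + e = ((q + ⟨p + e, h1⟩ : P) : Fin n → ℤ) := by
          rw [AddSubmonoid.coe_add, add_left_comm, add_assoc]
        rw [h2, weightVector_of_mem h1, weightVector_of_mem (Subtype.mem _), mul_smul_comm, ← hbm]
    induction x using basis_induction b with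
    | hb p =>
      induction y using basis_induction b with
      | hb q =>
        rw [← hbm, b.constr_basis, b.constr_basis, b.constr_basis, map_add, add_smul, smul_eq_mul,
          smul_eq_mul, hmul, hmul, AddSubmonoid.coe_add, add_comm (q : Fin n → ℤ), add_comm]
      | h0 => simp
      | hadd x y hx hy =>
        rw [mul_add, map_add, hx, hy, map_add, smul_add, add_smul]
        abel
      | hsmul c x hx =>
        rw [mul_smul_comm, map_smul, hx, map_smul, smul_add, smul_assoc, smul_comm (b p) c]
    | h0 => simp
    | hadd x y hx hy =>
      rw [add_mul, map_add, hx, hy, map_add, smul_add, add_smul]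
      abel
    | hsmul c x hx =>
      rw [smul_mul_assoc, map_smul, hx, map_smul, smul_add, smul_assoc, smul_comm y c]

theorem homogeneousDerivation_basis (hbm : ∀ p q, b (p + q) = b p * b q)
    (h : ∀ p : P, ℓ p ≠ 0 → (p : Fin n → ℤ) + e ∈ P) (p : P) :
    homogeneousDerivation ℓ e hbm h (b p) = ℓ p • weightVector b (p + e) :=
  b.constr_basis K _ p

/-- A nonzero homogeneous derivation whose degree points out of the weight monoid obstructs
rigidity. -/
theorem not_isRigid_of_degree [CharZero K] [IsDomain A] (hbm : ∀ p q, b (p + q) = b p * b q)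
    (h : ∀ p : P, ℓ p ≠ 0 → (p : Fin n → ℤ) + e ∈ P)
    (hnil : ∀ p : P, ∃ k : ℕ, (p : Fin n → ℤ) + k • e ∉ P) (hne : ∃ p, ℓ p ≠ 0) :
    ¬ IsRigid K A := by
  let D := homogeneousDerivation ℓ e hbm h
  have hD : ∀ v, ∃ c : K, D (weightVector b v) = c • weightVector b (v + e) := by
    intro v
    by_cases hv : v ∈ P
    · exact ⟨ℓ ⟨v, hv⟩, by
        rw [weightVector_of_mem hv]; exact homogeneousDerivation_basis ℓ e hbm h ⟨v, hv⟩⟩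
    · exact ⟨0, by rw [weightVector_of_notMem hv, map_zero, zero_smul]⟩
  have hiter : ∀ (p : P) (k : ℕ), ∃ c : K, D^[k] (b p) = c • weightVector b (p + k • e) := by
    intro p k
    induction k with
    | zero => exact ⟨1, by rw [zero_smul, add_zero, weightVector_of_mem p.2, one_smul]; rfl⟩
    | succ k ih =>
      obtain ⟨c, hc⟩ := ih
      obtain ⟨c', hc'⟩ := hD (p + k • e)
      refine ⟨c * c', ?_⟩
      rw [Function.iterate_succ_apply', hc, D.map_smul, hc', smul_smul, succ_nsmul, add_assoc]
  have hmono : ∀ {a : A} {k : ℕ}, D^[k] a = 0 → ∀ j, D^[j + k] a = 0 := fun h j => by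
    rw [Function.iterate_add_apply, h, iterate_map_zero]
  refine not_isRigid_of_derivation D (fun a => ?_) fun h0 => ?_
  · induction a using basis_induction b with
    | hb p =>
      obtain ⟨k, hk⟩ := hnil p
      obtain ⟨c, hc⟩ := hiter p k
      exact ⟨k, by rw [hc, weightVector_of_notMem hk, smul_zero]⟩
    | h0 => exact ⟨0, rfl⟩
    | hadd x y hx hy =>
      obtain ⟨k, hk⟩ := hx
      obtain ⟨k', hk'⟩ := hy
      exact ⟨k + k', by rw [iterate_map_add, hmono hk', add_zero, add_comm, hmono hk]⟩
    | hsmul c x hx =>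
      obtain ⟨k, hk⟩ := hx
      have : D^[k] (c • x) = c • D^[k] x :=
        Function.Commute.iterate_left (f := D) (g := (c • ·)) (fun x => D.map_smul c x) k x
      exact ⟨k, by rw [this, hk, smul_zero]⟩
  · obtain ⟨p, hp⟩ := hne
    have h1 := homogeneousDerivation_basis ℓ e hbm h p
    rw [weightVector_of_mem (h p hp)] at h1
    have h2 : D (b p) = 0 := by rw [h0]; rfl
    exact smul_ne_zero hp (b.ne_zero _) (h1.symm.trans h2)

end Homogeneous

/-- A rigid variety has no smooth points outside the open orbit. -/
theorem not_isRigid_of_smooth_of_eq_zero [CharZero K] [IsDomain A] [Algebra.FiniteType K A]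
    (hb0 : b 0 = 1) (hbm : ∀ p q, b (p + q) = b p * b q) {x : A →ₐ[K] K}
    (hx : x ∈ smoothPoints K A) {p₀ : P} (hp₀ : x (b p₀) = 0) : ¬ IsRigid K A := by
  let I : Ideal A := Ideal.span {a | ∃ p, x (b p) = 0 ∧ b p = a}
  have hI0 : I ≠ ⊥ := fun h => b.ne_zero p₀ (by
    have : b p₀ ∈ I := Ideal.subset_span ⟨p₀, hp₀, rfl⟩
    simpa [h] using this)
  have hI : ∀ f ∈ I, x f = 0 := by
    have : I ≤ RingHom.ker x := Ideal.span_le.2 (by rintro _ ⟨p, hp, rfl⟩; exact hp)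
    exact this
  obtain ⟨D, f, hf, hDf⟩ := exists_derivation_notMem x hx I hI0 hI
  have hp : ∃ p, x (b p) = 0 ∧ D (b p) ∉ I := by
    by_contra! hcon
    refine hDf (Submodule.span_induction (p := fun j _ => D j ∈ I) ?_ ?_ ?_ ?_ hf)
    · rintro _ ⟨p, hp, rfl⟩
      exact hcon p hp
    · rw [map_zero]
      exact zero_mem _
    · intro a b _ _ ha hb
      rw [map_add]
      exact add_mem ha hb
    · intro r a ha hDa
      rw [smul_eq_mul, Derivation.leibniz]
      refine add_mem (Ideal.mul_mem_left _ _ hDa) ?_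
      rw [smul_eq_mul, mul_comm]
      exact Ideal.mul_mem_left _ _ ha
  obtain ⟨p, hp, hDp⟩ := hp
  -- Terms whose basis vector vanishes at x lie in `I`, so a value outside `I` must contain another
  -- term.
  have hq : ∃ q, x (b q) ≠ 0 ∧ b.repr (D (b p)) q ≠ 0 := by
    by_contra! hcon
    refine hDp ?_
    rw [← b.linearCombination_repr (D (b p)), Finsupp.linearCombination_apply]
    refine sum_mem fun q _ => ?_
    change b.repr (D (b p)) q • b q ∈ I
    by_cases hxq : x (b q) = 0
    · rw [Algebra.smul_def]
      exact Ideal.mul_mem_left _ _ (Ideal.subset_span ⟨q, hxq, rfl⟩)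
    · rw [hcon q hxq, zero_smul]
      exact zero_mem _
  obtain ⟨q, hxq, hq⟩ := hq
  refine not_isRigid_of_degree (degreeComponent hb0 hbm D (q - p)) (q - p) hbm
    (fun p' hp' => mem_of_weightCoeff_ne_zero b hp') (fun p' => ?_) ⟨p, ?_⟩
  -- If p' + k(q - p) stayed in `P`, then b(p')·b(q)^k would be divisible by b(p)^k for every k,
  -- against Krull's theorem at x.
  · by_contra! hcon
    have hpow : ∀ (r : P) (k : ℕ), b (k • r) = b r ^ k := by
      intro r k
      induction k with
      | zero => rw [zero_smul, hb0, pow_zero]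
      | succ k ih => rw [succ_nsmul, hbm, ih, pow_succ]
    refine b.ne_zero p' (eq_zero_of_mul_mem_pow x hxq hp fun k => ⟨b ⟨_, hcon k⟩, ?_⟩)
    rw [← hpow, ← hpow, ← hbm, ← hbm]
    congr 1
    ext1
    rw [AddSubmonoid.coe_add, AddSubmonoid.coe_add, AddSubmonoidClass.coe_nsmul,
      AddSubmonoidClass.coe_nsmul]
    change (p' : Fin n → ℤ) + k • ((q : Fin n → ℤ) - p) + k • (p : Fin n → ℤ) = _
    rw [smul_sub, add_assoc, sub_add_cancel]
  · rw [degreeComponent_apply, add_sub_cancel, weightCoeff_coe]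
    exact hq

/-! ### The leading component of a locally nilpotent derivation. -/

section LeadingDegree

theorem weightCoeff_derivation (D : Derivation K A A) (v : Fin n → ℤ) (a : A) :
    weightCoeff b v (D a) = (b.repr a).sum fun q c => c * weightCoeff b v (D (b q)) := by
  conv_lhs => rw [← b.linearCombination_repr a, Finsupp.linearCombination_apply]
  rw [map_finsuppSum, map_finsuppSum]
  refine Finsupp.sum_congr fun q _ => ?_
  rw [D.map_smul, map_smul, smul_eq_mul]

/-- Each component is additive, so it is determined by finitely many generators of `P`, and `D`
sends each of those basis vectors to finitely many terms. -/
theorem finite_degrees (hP : P.FG) (hb0 : b 0 = 1) (hbm : ∀ p q, b (p + q) = b p * b q)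
    (D : Derivation K A A) : {e | degreeComponent hb0 hbm D e ≠ 0}.Finite := by
  classical
  obtain ⟨G, hG⟩ := (AddMonoid.fg_iff_addSubmonoid_fg P).2 hP
  refine Set.Finite.subset (G.biUnion fun g => (b.repr (D (b g))).support.image
    fun v : P => (v : Fin n → ℤ) - (g : Fin n → ℤ)).finite_toSet fun e he => ?_
  have h : ∃ g ∈ G, degreeComponent hb0 hbm D e g ≠ 0 := by
    by_contra! hcon
    refine he (AddMonoidHom.eq_of_eqOn_denseM hG fun g hg => ?_)
    rw [hcon g hg, AddMonoidHom.zero_apply]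
  obtain ⟨g, hg, hge⟩ := h
  have hmem := mem_of_weightCoeff_ne_zero b hge
  rw [degreeComponent_apply, weightCoeff_of_mem b hmem] at hge
  rw [Finset.mem_coe, Finset.mem_biUnion]
  refine ⟨g, hg, Finset.mem_image.2 ⟨⟨_, hmem⟩, Finsupp.mem_support_iff.2 hge, ?_⟩⟩
  rw [add_sub_cancel_left]

/-- The leading homogeneous component of a locally nilpotent derivation is locally nilpotent. -/
theorem exists_degree_of_derivation (hP : P.FG) (hb0 : b 0 = 1)
    (hbm : ∀ p q, b (p + q) = b p * b q) (D : Derivation K A A) (hD0 : D ≠ 0)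
    (hD : ∀ a, ∃ k, D^[k] a = 0) :
    ∃ (e : Fin n → ℤ) (ℓ : P →+ K), ℓ ≠ 0 ∧ (∀ p : P, ℓ p ≠ 0 → (p : Fin n → ℤ) + e ∈ P) ∧
      ∀ p : P, ∃ (k : ℕ) (hk : ∀ j ≤ k, (p : Fin n → ℤ) + j • e ∈ P),
        ℓ ⟨p + k • e, hk k le_rfl⟩ = 0 := by
  have hne : {e | degreeComponent hb0 hbm D e ≠ 0}.Nonempty := by
    by_contra hcon
    rw [Set.not_nonempty_iff_eq_empty, Set.eq_empty_iff_forall_notMem] at hcon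
    simp only [Set.mem_ofPred_eq, not_not] at hcon
    refine hD0 (Derivation.ext fun a => ?_)
    induction a using basis_induction b with
    | hb p =>
      rw [Derivation.zero_apply]
      refine eq_zero_of_forall_weightCoeff b fun v => ?_
      have h1 := DFunLike.congr_fun (hcon (v - p)) p
      rwa [degreeComponent_apply, add_sub_cancel] at h1
    | h0 => rw [map_zero, map_zero]
    | hadd x y hx hy => rw [map_add, map_add, hx, hy]
    | hsmul c x hx => rw [D.map_smul, hx, Derivation.zero_apply, Derivation.zero_apply, smul_zero]
  -- The lexicographic order is total and translation invariant, so top-degree terms cannot cancel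
  -- against others.
  obtain ⟨e, he, hmax⟩ := Set.exists_max_image _ (fun v : Fin n → ℤ => toLex v)
    (finite_degrees hP hb0 hbm D) hne
  have hzero : ∀ v q : Fin n → ℤ, ∀ hq : q ∈ P, toLex (q + e) < toLex v →
      weightCoeff b v (D (b ⟨q, hq⟩)) = 0 := by
    intro v q hq hlt
    by_contra hcon
    have h1 : degreeComponent hb0 hbm D (v - q) ≠ 0 := fun h => hcon (by
      have := DFunLike.congr_fun h ⟨q, hq⟩
      rwa [degreeComponent_apply, add_sub_cancel] at this)
    have h2 := hmax _ h1
    rw [← not_lt] at h2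
    apply h2
    rw [toLex_sub, lt_sub_iff_add_lt, ← toLex_add, add_comm]
    exact hlt
  have hstep : ∀ (w : Fin n → ℤ) (a : A),
      (∀ v, toLex w < toLex v → weightCoeff b v a = 0) →
      (∀ v, toLex (w + e) < toLex v → weightCoeff b v (D a) = 0) ∧
      ∀ hw : w ∈ P, weightCoeff b (w + e) (D a) =
        weightCoeff b w a * degreeComponent hb0 hbm D e ⟨w, hw⟩ := by
    intro w a ha
    have hle : ∀ q ∈ (b.repr a).support, toLex (q : Fin n → ℤ) ≤ toLex w := by
      intro q hq
      by_contra hlt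
      rw [Finsupp.mem_support_iff, ← weightCoeff_coe] at hq
      exact hq (ha _ (not_le.1 hlt))
    constructor
    · intro v hv
      rw [weightCoeff_derivation]
      refine Finset.sum_eq_zero fun q hq => ?_
      change _ * weightCoeff b v (D (b q)) = 0
      rw [hzero v q q.2 (lt_of_le_of_lt ?_ hv), mul_zero]
      rw [toLex_add, toLex_add]
      exact add_le_add_left (hle q hq) _
    · intro hw
      rw [weightCoeff_derivation, Finsupp.sum, Finset.sum_eq_single ⟨w, hw⟩,
        weightCoeff_of_mem b hw, degreeComponent_apply]
      · intro q hq hqw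
        rw [hzero _ q q.2, mul_zero]
        rw [toLex_add, toLex_add]
        refine add_lt_add_left (lt_of_le_of_ne (hle q hq) fun h => hqw ?_) _
        exact Subtype.ext (toLex.injective h)
      · intro hq
        rw [Finsupp.notMem_support_iff.1 hq, zero_mul]
  refine ⟨e, degreeComponent hb0 hbm D e, he, fun p hp => mem_of_weightCoeff_ne_zero b hp,
    fun p => ?_⟩
  by_contra! hcon
  -- If ℓ never vanished along p + je, the leading coefficient of D^k(b p) would be a product of
  -- nonzero factors, contradicting nilpotency.
  have hall : ∀ k : ℕ, (∀ j ≤ k, (p : Fin n → ℤ) + j • e ∈ P) ∧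
      weightCoeff b (p + k • e) (D^[k] (b p)) ≠ 0 ∧
      ∀ v, toLex ((p : Fin n → ℤ) + k • e) < toLex v → weightCoeff b v (D^[k] (b p)) = 0 := by
    intro k
    induction k with
    | zero =>
      refine ⟨fun j hj => ?_, ?_, fun v hv => ?_⟩
      · rw [Nat.le_zero.1 hj, zero_smul, add_zero]
        exact p.2
      · rw [zero_smul, add_zero, Function.iterate_zero_apply, weightCoeff_basis, if_pos rfl]
        exact one_ne_zero
      · rw [zero_smul, add_zero] at hv
        rw [Function.iterate_zero_apply, weightCoeff_basis, if_neg]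
        rintro rfl
        exact lt_irrefl _ hv
    | succ k ih =>
      obtain ⟨h1, h2, h3⟩ := ih
      have hℓ := hcon k h1
      obtain ⟨h4, h5⟩ := hstep _ _ h3
      have hs : (p : Fin n → ℤ) + (k + 1) • e = p + k • e + e := by rw [succ_nsmul, add_assoc]
      refine ⟨fun j hj => ?_, ?_, ?_⟩
      · rcases Nat.lt_or_eq_of_le hj with hj | rfl
        · exact h1 j (Nat.lt_succ_iff.1 hj)
        · rw [hs]
          exact mem_of_weightCoeff_ne_zero b hℓ
      · rw [hs, Function.iterate_succ_apply', h5 (h1 k le_rfl)]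
        exact mul_ne_zero h2 hℓ
      · rw [hs, Function.iterate_succ_apply']
        exact h4
  obtain ⟨k, hk⟩ := hD (b p)
  refine (hall k).2.1 ?_
  rw [hk, map_zero]

end LeadingDegree

end Graded

/-! ### Facets, saturation points and degrees of derivations. -/

section Cone

variable {n : ℕ}

/-- The inclusion of the lattice `ℤⁿ` into `ℚⁿ` as a homomorphism. -/
def toRatHom (n : ℕ) : (Fin n → ℤ) →+ (Fin n → ℚ) where
  toFun := toRat
  map_zero' := by ext; simp [toRat]
  map_add' a b := by ext; simp [toRat]

theorem toRat_eq_toRatHom (v : Fin n → ℤ) : toRat v = toRatHom n v := rfl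

variable {P : AddSubmonoid (Fin n → ℤ)}

theorem toRat_mem_weightCone {v : Fin n → ℤ} (hv : v ∈ P) : toRat v ∈ weightCone P :=
  PointedCone.subset_hull ⟨v, hv, rfl⟩

theorem smul_mem_cone {C : PointedCone ℚ (Fin n → ℚ)} {q : ℚ} (hq : 0 ≤ q) {x : Fin n → ℚ}
    (hx : x ∈ C) : q • x ∈ C :=
  C.smul_mem hq hx

theorem weightCone_induction {p : ∀ c, c ∈ weightCone P → Prop}
    (hb : ∀ v (hv : v ∈ P), p (toRat v) (toRat_mem_weightCone hv)) (h0 : p 0 (zero_mem _))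
    (hadd : ∀ x y hx hy, p x hx → p y hy → p (x + y) (add_mem hx hy))
    (hsmul : ∀ (q : ℚ) x (hq : 0 ≤ q) hx, p x hx → p (q • x) (smul_mem_cone hq hx))
    {c : Fin n → ℚ} (hc : c ∈ weightCone P) : p c hc :=
  Submodule.span_induction (by rintro _ ⟨v, hv, rfl⟩; exact hb v hv) h0
    hadd (fun q x => hsmul q x q.2) hc

/-- A multiple of a rational point of the weight cone is a weight. -/
theorem exists_nsmul_eq_toRat {c : Fin n → ℚ} (hc : c ∈ weightCone P) :
    ∃ N : ℕ, 0 < N ∧ ∃ t ∈ P, N • c = toRat t := by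
  induction hc using weightCone_induction with
  | hb v hv => exact ⟨1, one_pos, v, hv, one_smul _ _⟩
  | h0 => exact ⟨1, one_pos, 0, zero_mem _, by rw [smul_zero]; exact (map_zero (toRatHom n)).symm⟩
  | hadd x y _ _ hx hy =>
    obtain ⟨N, hN, t, ht, hx⟩ := hx
    obtain ⟨N', hN', t', ht', hy⟩ := hy
    refine ⟨N * N', Nat.mul_pos hN hN', N' • t + N • t',
      add_mem (nsmul_mem ht _) (nsmul_mem ht' _), ?_⟩
    rw [toRat_eq_toRatHom] at hx hy ⊢
    rw [map_add, map_nsmul, map_nsmul, ← hx, ← hy, smul_add, smul_smul, smul_smul, mul_comm N']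
  | hsmul q x hq _ hx =>
    obtain ⟨N, hN, t, ht, hx⟩ := hx
    refine ⟨q.den * N, Nat.mul_pos q.den_pos hN, q.num.toNat • t, nsmul_mem ht _, ?_⟩
    rw [toRat_eq_toRatHom] at hx ⊢
    rw [map_nsmul, ← hx, ← Nat.cast_smul_eq_nsmul ℚ, ← Nat.cast_smul_eq_nsmul ℚ,
      ← Nat.cast_smul_eq_nsmul ℚ, smul_smul, smul_smul]
    congr 1
    have h1 : ((q.num.toNat : ℕ) : ℚ) = q.num := by
      rw [← Int.cast_natCast, Int.toNat_of_nonneg (Rat.num_nonneg.2 hq)]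
    rw [h1, ← Rat.mul_den_eq_num]
    push_cast
    ring

theorem toRat_eq_sum (v : Fin n → ℚ) : v = ∑ i, v i • toRat (Pi.single i (1 : ℤ)) := by
  ext j
  simp [Finset.sum_apply, toRat, Pi.single_apply]

theorem span_weightCone (htop : AddSubgroup.closure (P : Set (Fin n → ℤ)) = ⊤) :
    Submodule.span ℚ (weightCone P : Set (Fin n → ℚ)) = ⊤ := by
  rw [eq_top_iff]
  intro x _
  rw [toRat_eq_sum x]
  refine sum_mem fun i _ => Submodule.smul_mem _ _ ?_
  obtain ⟨u, hu, w, hw, h⟩ := (mem_closure_iff_exists_sub P).1 (htop ▸ AddSubgroup.mem_top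
    (Pi.single i (1 : ℤ) : Fin n → ℤ))
  rw [h, toRat_eq_toRatHom, map_sub]
  exact sub_mem (Submodule.subset_span (toRat_mem_weightCone hu))
    (Submodule.subset_span (toRat_mem_weightCone hw))

theorem mem_span_cone {τ : PointedCone ℚ (Fin n → ℚ)} {x : Fin n → ℚ}
    (hx : x ∈ Submodule.span ℚ (τ : Set (Fin n → ℚ))) : ∃ a ∈ τ, ∃ c ∈ τ, x = a - c := by
  induction hx using Submodule.span_induction with
  | mem x hx => exact ⟨x, hx, 0, zero_mem _, (sub_zero x).symm⟩
  | zero => exact ⟨0, zero_mem _, 0, zero_mem _, (sub_zero 0).symm⟩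
  | add x y _ _ hx hy =>
    obtain ⟨a, ha, c, hc, rfl⟩ := hx
    obtain ⟨a', ha', c', hc', rfl⟩ := hy
    exact ⟨a + a', add_mem ha ha', c + c', add_mem hc hc', by abel⟩
  | smul q x _ hx =>
    obtain ⟨a, ha, c, hc, rfl⟩ := hx
    rcases le_total 0 q with hq | hq
    · exact ⟨q • a, smul_mem_cone hq ha, q • c, smul_mem_cone hq hc, smul_sub _ _ _⟩
    · refine ⟨(-q) • c, smul_mem_cone (neg_nonneg.2 hq) hc, (-q) • a,
        smul_mem_cone (neg_nonneg.2 hq) ha, ?_⟩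
      rw [neg_smul, neg_smul, smul_sub]
      abel

theorem finrank_ker_add_one {f : (Fin n → ℚ) →ₗ[ℚ] ℚ} (hf : f ≠ 0) :
    Module.finrank ℚ (LinearMap.ker f) + 1 = Module.finrank ℚ (Fin n → ℚ) := by
  rw [← LinearMap.finrank_range_add_finrank_ker f, LinearMap.range_eq_top.2
    (LinearMap.surjective hf), finrank_top, Module.finrank_self, add_comm]

/-- The coordinates of a point of the weight cone in terms of generators. -/
theorem exists_coordinates {G : Finset (Fin n → ℤ)} (hG : AddSubmonoid.closure (G : Set _) = P)
    {c : Fin n → ℚ} (hc : c ∈ weightCone P) :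
    ∃ q : (Fin n → ℤ) → ℚ, (∀ g, 0 ≤ q g) ∧ c = ∑ g ∈ G, q g • toRat g := by
  classical
  induction hc using weightCone_induction with
  | hb v hv =>
    rw [← hG] at hv
    induction hv using AddSubmonoid.closure_induction with
    | mem g hg =>
      refine ⟨Pi.single g 1, fun g' => ?_, ?_⟩
      · rw [Pi.single_apply]
        split_ifs <;> norm_num
      · rw [Finset.sum_eq_single g]
        · rw [Pi.single_eq_same, one_smul]
        · intro g' _ hne
          rw [Pi.single_eq_of_ne hne, zero_smul]
        · exact fun h => absurd hg h
    | zero =>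
      refine ⟨0, fun _ => le_rfl, ?_⟩
      rw [toRat_eq_toRatHom, map_zero]
      simp
    | add x y _ _ hx hy =>
      obtain ⟨q, hq, hx⟩ := hx
      obtain ⟨q', hq', hy⟩ := hy
      refine ⟨q + q', fun g => add_nonneg (hq g) (hq' g), ?_⟩
      rw [toRat_eq_toRatHom] at hx hy ⊢
      rw [map_add, hx, hy, ← Finset.sum_add_distrib]
      exact Finset.sum_congr rfl fun g _ => (add_smul _ _ _).symm
  | h0 => exact ⟨0, fun _ => le_rfl, by simp⟩
  | hadd x y _ _ hx hy =>
    obtain ⟨q, hq, rfl⟩ := hx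
    obtain ⟨q', hq', rfl⟩ := hy
    refine ⟨q + q', fun g => add_nonneg (hq g) (hq' g), ?_⟩
    rw [← Finset.sum_add_distrib]
    exact Finset.sum_congr rfl fun g _ => (add_smul _ _ _).symm
  | hsmul r x hr _ hx =>
    obtain ⟨q, hq, rfl⟩ := hx
    refine ⟨r • q, fun g => mul_nonneg hr (hq g), ?_⟩
    rw [Finset.smul_sum]
    exact Finset.sum_congr rfl fun g _ => smul_smul _ _ _

/-- A finitely generated monoid that generates the lattice has a saturation point. -/
theorem exists_isSaturationPoint (hP : P.FG)
    (htop : AddSubgroup.closure (P : Set (Fin n → ℤ)) = ⊤) : ∃ p, IsSaturationPoint P p := by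
  obtain ⟨G, hG⟩ := hP
  have hGP : ∀ g ∈ G, g ∈ P := fun g hg => hG ▸ AddSubmonoid.subset_closure hg
  have hex : ∀ v : Fin n → ℤ, ∃ u ∈ P, ∃ w ∈ P, v = u - w := fun v =>
    (mem_closure_iff_exists_sub P).1 (htop ▸ AddSubgroup.mem_top v)
  choose u hu w hw huw using hex
  -- The box [-B, B] contains every combination of generators with coefficients in [0, 1). Its
  -- finitely many lattice points are v = u v - w v, so adding all the w v moves each of them into
  -- `P`.
  let B : Fin n → ℤ := fun i => ∑ g ∈ G, |g i|
  refine ⟨∑ v ∈ Finset.Icc (-B) B, w v, sum_mem fun v _ => hw v, ?_⟩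
  rintro m ⟨c, hc, hm⟩
  obtain ⟨q, hq, rfl⟩ := exists_coordinates hG hc
  let s : Fin n → ℤ := ∑ g ∈ G, ⌊q g⌋.toNat • g
  have hs : s ∈ P := sum_mem fun g hg => nsmul_mem (hGP g hg) _
  let v : Fin n → ℤ := m - (∑ v ∈ Finset.Icc (-B) B, w v) - s
  have hv : toRat v = ∑ g ∈ G, Int.fract (q g) • toRat g := by
    rw [toRat_eq_toRatHom] at hm ⊢
    rw [map_sub, map_sub, hm, toRat_eq_toRatHom, add_sub_cancel_left, map_sum, ← Finset.sum_sub_distrib]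
    refine Finset.sum_congr rfl fun g _ => ?_
    rw [map_nsmul, ← Nat.cast_smul_eq_nsmul ℚ, ← toRat_eq_toRatHom, ← sub_smul, Int.fract]
    congr 2
    rw [← Int.cast_natCast, Int.toNat_of_nonneg (Int.floor_nonneg.2 (hq g))]
  have habs : ∀ i, |v i| ≤ B i := by
    intro i
    have h1 : ((|v i| : ℤ) : ℚ) ≤ ((B i : ℤ) : ℚ) := by
      have h2 : (v i : ℚ) = ∑ g ∈ G, Int.fract (q g) * (g i : ℚ) := by
        have := congrFun hv i
        rw [Finset.sum_apply] at this
        exact this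
      rw [Int.cast_abs, h2]
      refine (Finset.abs_sum_le_sum_abs _ _).trans ?_
      simp only [B, Int.cast_sum, Int.cast_abs]
      refine Finset.sum_le_sum fun g _ => ?_
      rw [abs_mul, abs_of_nonneg (Int.fract_nonneg _)]
      exact mul_le_of_le_one_left (abs_nonneg _) (Int.fract_lt_one _).le
    exact_mod_cast h1
  have hmem : v ∈ Finset.Icc (-B) B := by
    rw [Finset.mem_Icc]
    exact ⟨fun i => (abs_le.1 (habs i)).1, fun i => (abs_le.1 (habs i)).2⟩
  classical
  have hsum : m = ∑ v' ∈ (Finset.Icc (-B) B).erase v, w v' + (u v + s) := by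
    have h1 : m = ∑ v' ∈ Finset.Icc (-B) B, w v' + (v + s) := by simp only [v]; abel
    have h2 : v + w v = u v := (eq_sub_iff_add_eq.1 (huw v))
    rw [h1, ← Finset.sum_erase_add _ _ hmem, ← h2]
    abel
  rw [hsum]
  exact add_mem (sum_mem fun v _ => hw v) (add_mem (hu v) hs)

/-- The linear form that defines a facet. -/
theorem IsFacet.exists_linearForm (htop : AddSubgroup.closure (P : Set (Fin n → ℤ)) = ⊤)
    {τ : PointedCone ℚ (Fin n → ℚ)} (hτ : IsFacet τ (weightCone P)) :
    ∃ f : (Fin n → ℚ) →ₗ[ℚ] ℚ, LinearMap.ker f = Submodule.span ℚ (τ : Set (Fin n → ℚ)) ∧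
      (∀ c ∈ weightCone P, 0 ≤ f c) ∧ ∃ m ∈ P, 0 < f (toRat m) := by
  obtain ⟨hface, hdim⟩ := hτ
  rw [span_weightCone htop, finrank_top] at hdim
  obtain ⟨f, hf0, hle⟩ := Submodule.exists_le_ker_of_lt_top
    (Submodule.span ℚ (τ : Set (Fin n → ℚ))) (by
      rw [lt_top_iff_ne_top]
      intro h
      rw [h, finrank_top] at hdim
      omega)
  have hker : LinearMap.ker f = Submodule.span ℚ (τ : Set (Fin n → ℚ)) := by
    refine (Submodule.eq_of_le_of_finrank_eq hle ?_).symm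
    have := finrank_ker_add_one hf0
    omega
  have hex : ∃ f' : (Fin n → ℚ) →ₗ[ℚ] ℚ, LinearMap.ker f' =
      Submodule.span ℚ (τ : Set (Fin n → ℚ)) ∧ ∃ m ∈ P, 0 < f' (toRat m) := by
    have h1 : ∃ m ∈ P, f (toRat m) ≠ 0 := by
      by_contra! hcon
      refine hf0 (LinearMap.ker_eq_top.1 (top_le_iff.1 ?_))
      rw [← span_weightCone htop, Submodule.span_le]
      intro c hc
      refine weightCone_induction (p := fun c _ => f c = 0) hcon (map_zero f)
        (fun x y _ _ hx hy => ?_) (fun q x _ _ hx => ?_) hc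
      · rw [map_add, hx, hy, add_zero]
      · rw [map_smul, hx, smul_zero]
    obtain ⟨m, hm, hfm⟩ := h1
    rcases lt_or_gt_of_ne hfm with h | h
    · refine ⟨-f, ?_, m, hm, neg_pos.2 h⟩
      rw [← hker]
      ext x
      simp
    · exact ⟨f, hker, m, hm, h⟩
  obtain ⟨f', hker', m, hm, hfm⟩ := hex
  refine ⟨f', hker', fun c hc => ?_, m, hm, hfm⟩
  -- A point c of the cone with negative value combines positively with m to a point of span τ.
  -- Being in the cone as well, this point lies in τ, and the face property then puts c in τ, where
  -- the form is zero.
  by_contra! hneg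
  have hz : f' (toRat m) • c + (-f' c) • toRat m ∈ LinearMap.ker f' := by
    rw [LinearMap.mem_ker, map_add, map_smul, map_smul, smul_eq_mul, smul_eq_mul]
    ring
  rw [hker'] at hz
  obtain ⟨x, hx, y, hy, hxy⟩ := mem_span_cone hz
  have hzC : f' (toRat m) • c + (-f' c) • toRat m ∈ weightCone P :=
    add_mem (smul_mem_cone hfm.le hc)
      (smul_mem_cone (neg_nonneg.2 hneg.le) (toRat_mem_weightCone hm))
  have hzτ : f' (toRat m) • c + (-f' c) • toRat m ∈ τ := by
    refine hface.mem_of_add_mem_left hzC (hface.le hy) ?_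
    rw [hxy, sub_add_cancel]
    exact hx
  have hcτ : c ∈ LinearMap.ker f' := by
    rw [hker']
    exact Submodule.subset_span (hface.mem_of_smul_add_smul_mem_left hc (toRat_mem_weightCone hm)
      hfm (neg_pos.2 hneg) hzτ)
  exact hneg.ne hcτ

/-- An almost saturated facet provides a degree of a locally nilpotent derivation. -/
theorem exists_degree_of_isAlmostSaturated (hP : P.FG)
    (htop : AddSubgroup.closure (P : Set (Fin n → ℤ)) = ⊤) {τ : PointedCone ℚ (Fin n → ℚ)}
    (hτ : IsFacet τ (weightCone P)) (hsat : IsAlmostSaturated P τ) :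
    ∃ (e : Fin n → ℤ) (ℓ : P →+ ℚ), (∀ p : P, ℓ p ≠ 0 → (p : Fin n → ℤ) + e ∈ P) ∧
      (∀ p : P, ∃ k : ℕ, (p : Fin n → ℤ) + k • e ∉ P) ∧ ∃ p, ℓ p ≠ 0 := by
  obtain ⟨f, hker, hpos, m₁, hm₁, hfm₁⟩ := hτ.exists_linearForm htop
  obtain ⟨p, ⟨hpP, hp⟩, hpτ⟩ := hsat
  obtain ⟨G, hG⟩ := hP
  have hGP : ∀ g ∈ G, g ∈ P := fun g hg => hG ▸ AddSubmonoid.subset_closure hg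
  let F : (Fin n → ℤ) →+ ℚ := (f : (Fin n → ℚ) →+ ℚ).comp (toRatHom n)
  have hF : ∀ v, F v = f (toRat v) := fun v => rfl
  have hFP : ∀ v ∈ P, 0 ≤ F v := fun v hv => hpos _ (toRat_mem_weightCone hv)
  have hτ0 : ∀ c ∈ τ, f c = 0 := fun c hc => by
    have : c ∈ LinearMap.ker f := hker ▸ Submodule.subset_span hc
    exact this
  have hex : (G.filter fun g => 0 < F g).Nonempty := by
    by_contra hcon
    rw [Finset.not_nonempty_iff_eq_empty, Finset.filter_eq_empty_iff] at hcon
    have h1 : P ≤ AddMonoidHom.mker F := by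
      rw [← hG, AddSubmonoid.closure_le]
      exact fun g hg => le_antisymm (not_lt.1 (hcon hg)) (hFP g (hGP g hg))
    exact hfm₁.ne' (h1 hm₁)
  -- Least positive value: g - m₀ then stays in the half-space F ≥ 0 for every generator g off the
  -- facet.
  obtain ⟨m₀, hm₀, hmin⟩ := Finset.exists_min_image _ F hex
  rw [Finset.mem_filter] at hm₀
  -- Modulo span τ, a vector with F ≥ 0 is a nonnegative multiple of m₀, so a large enough weight on
  -- the facet pushes it into the cone. The other vectors get t = 0.
  have hshift : ∀ v : Fin n → ℤ, ∃ t ∈ P, F t = 0 ∧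
      (0 ≤ F v → toRat v + toRat t ∈ weightCone P) := by
    intro v
    by_cases hv : 0 ≤ F v
    · have hw : toRat v - (F v / F m₀) • toRat m₀ ∈ LinearMap.ker f := by
        rw [LinearMap.mem_ker, map_sub, map_smul, ← hF, ← hF, smul_eq_mul,
          div_mul_cancel₀ _ hm₀.2.ne', sub_self]
      rw [hker] at hw
      obtain ⟨x, hx, y, hy, hxy⟩ := mem_span_cone hw
      obtain ⟨N, hN, t, ht, hNt⟩ := exists_nsmul_eq_toRat (hτ.1.le hy)
      refine ⟨t, ht, by rw [hF, ← hNt, map_nsmul, hτ0 y hy, smul_zero], fun _ => ?_⟩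
      obtain ⟨N, rfl⟩ := Nat.exists_eq_add_of_lt hN
      have h1 : toRat v + toRat t = (F v / F m₀) • toRat m₀ + x + N • y := by
        rw [← hNt, sub_eq_iff_eq_add.1 hxy, zero_add, succ_nsmul]
        abel
      rw [h1]
      exact add_mem (add_mem (smul_mem_cone (div_nonneg hv hm₀.2.le)
        (toRat_mem_weightCone (hGP _ hm₀.1))) (hτ.1.le hx)) (nsmul_mem (hτ.1.le hy) N)
    · exact ⟨0, zero_mem _, map_zero F, fun h => absurd h hv⟩
  choose t htP htF htC using hshift
  -- For a generator g off the facet, g + e is p plus the cone vector g - m₀ + t(g - m₀) plus the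
  -- remaining t's, so saturation at p applies. All terms but -m₀ have F = 0.
  let e : Fin n → ℤ := p + ∑ g ∈ G, t (g - m₀) - m₀
  have hFe : F e = -F m₀ := by
    rw [map_sub, map_add, map_sum, hF p, hτ0 _ hpτ, Finset.sum_eq_zero fun g _ => htF _]
    ring
  have hadd : ∀ v ∈ P, F v = 0 ∨ v + e ∈ P := by
    intro v hv
    rw [← hG] at hv
    induction hv using AddSubmonoid.closure_induction with
    | mem g hg =>
      rcases (hFP g (hGP g hg)).eq_or_lt with h0 | h0
      · exact Or.inl h0.symm
      · right
        classical
        refine hp _ ⟨toRat (g - m₀) + toRat (t (g - m₀)) +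
          toRat (∑ g' ∈ G.erase g, t (g' - m₀)), ?_, ?_⟩
        · refine add_mem (htC _ ?_) (toRat_mem_weightCone (sum_mem fun g' _ => htP _))
          rw [map_sub, sub_nonneg]
          exact hmin g (Finset.mem_filter.2 ⟨hg, h0⟩)
        · simp only [toRat_eq_toRatHom, ← map_add]
          congr 1
          simp only [e]
          rw [← Finset.sum_erase_add _ _ hg]
          abel
    | zero => exact Or.inl (map_zero F)
    | add x y hxG hyG hx hy =>
      rw [hG] at hxG hyG
      rcases hx with hx | hx
      · rcases hy with hy | hy
        · exact Or.inl (by rw [map_add, hx, hy, add_zero])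
        · exact Or.inr (by rw [add_assoc]; exact add_mem hxG hy)
      · exact Or.inr (by rw [add_right_comm]; exact add_mem hx hyG)
  refine ⟨e, F.comp P.subtype, fun p hp => (hadd p p.2).resolve_left hp, fun q => ?_,
    ⟨m₁, hm₁⟩, hfm₁.ne'⟩
  obtain ⟨k, hk⟩ := exists_nat_gt (F q / F m₀)
  refine ⟨k, fun hmem => ?_⟩
  have h1 := hFP _ hmem
  rw [map_add, map_nsmul, hFe, nsmul_eq_mul] at h1
  rw [div_lt_iff₀ hm₀.2] at hk
  linarith

/-- A homogeneous locally nilpotent derivation provides an almost saturated facet. -/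
theorem exists_facet_of_degree (hP : P.FG) (htop : AddSubgroup.closure (P : Set (Fin n → ℤ)) = ⊤)
    (L : (Fin n → ℤ) →+ ℤ) (e : Fin n → ℤ) (he : L e = -1) (hL : ∀ p ∈ P, 0 ≤ L p)
    (hLe : ∀ p ∈ P, ∀ j : ℕ, (j : ℤ) ≤ L p → p + j • e ∈ P) :
    ∃ τ, IsFacet τ (weightCone P) ∧ IsAlmostSaturated P τ := by
  let f : (Fin n → ℚ) →ₗ[ℚ] ℚ :=
    ∑ i, (L (Pi.single i 1) : ℚ) • (LinearMap.proj i : (Fin n → ℚ) →ₗ[ℚ] ℚ)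
  have hf : ∀ v, f (toRat v) = L v := by
    intro v
    have h1 : v = ∑ i, v i • Pi.single i (1 : ℤ) := by
      ext j
      simp [Finset.sum_apply, Pi.single_apply]
    conv_rhs => rw [h1, map_sum]
    rw [LinearMap.sum_apply, Int.cast_sum]
    refine Finset.sum_congr rfl fun i _ => ?_
    rw [map_zsmul]
    simp [toRat, mul_comm]
  have hfC : ∀ c ∈ weightCone P, 0 ≤ f c := by
    intro c hc
    refine weightCone_induction (p := fun c _ => 0 ≤ f c) (fun v hv => ?_) (map_zero f).ge
      (fun x y _ _ hx hy => ?_) (fun q x hq _ hx => ?_) hc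
    · rw [hf]
      exact_mod_cast hL v hv
    · rw [map_add]
      exact add_nonneg hx hy
    · rw [map_smul]
      exact mul_nonneg hq hx
  have hf0 : f ≠ 0 := by
    intro h
    have h1 := hf e
    rw [h, he] at h1
    norm_num at h1
  have hproj : ∀ p ∈ P, p + (L p).toNat • e ∈ P ∧ L (p + (L p).toNat • e) = 0 := by
    intro p hp
    refine ⟨hLe p hp _ (Int.toNat_of_nonneg (hL p hp)).le, ?_⟩
    rw [map_add, map_nsmul, he, nsmul_eq_mul, Int.toNat_of_nonneg (hL p hp)]
    ring
  let τ : PointedCone ℚ (Fin n → ℚ) := weightCone P ⊓ PointedCone.ofSubmodule (LinearMap.ker f)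
  have hτ : ∀ c, c ∈ τ ↔ c ∈ weightCone P ∧ f c = 0 := fun c => Iff.rfl
  have hspan : Submodule.span ℚ (τ : Set (Fin n → ℚ)) = LinearMap.ker f := by
    apply le_antisymm
    · rw [Submodule.span_le]
      exact fun c hc => ((hτ c).1 hc).2
    · intro x hx
      -- Projection along e onto the kernel of f: since L(e) = -1, it sends a weight v to v + L(v)e,
      -- again a weight, so τ spans the kernel.
      let π : (Fin n → ℚ) →ₗ[ℚ] (Fin n → ℚ) := LinearMap.id + f.smulRight (toRat e)
      have hπ : ∀ y, π y ∈ Submodule.span ℚ (τ : Set (Fin n → ℚ)) := by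
        intro y
        have hy : y ∈ Submodule.span ℚ (weightCone P : Set (Fin n → ℚ)) := by
          rw [span_weightCone htop]
          exact Submodule.mem_top
        have hle : Submodule.span ℚ (weightCone P : Set (Fin n → ℚ)) ≤
            (Submodule.span ℚ (τ : Set (Fin n → ℚ))).comap π := by
          rw [Submodule.span_le]
          intro c hc
          refine weightCone_induction
            (p := fun c _ => π c ∈ Submodule.span ℚ (τ : Set (Fin n → ℚ))) (fun v hv => ?_) ?_
            (fun x y _ _ hx hy => ?_) (fun q x _ _ hx => ?_) hc
          · have h1 : π (toRat v) = toRat (v + (L v).toNat • e) := by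
              have h2 : f (toRat v) = ((L v).toNat : ℚ) := by
                rw [hf, ← Int.cast_natCast, Int.toNat_of_nonneg (hL v hv)]
              simp only [π, LinearMap.add_apply, LinearMap.id_apply, LinearMap.smulRight_apply]
              rw [h2, toRat_eq_toRatHom, toRat_eq_toRatHom, toRat_eq_toRatHom, map_add, map_nsmul,
                Nat.cast_smul_eq_nsmul]
            rw [h1]
            refine Submodule.subset_span ((hτ _).2
              ⟨toRat_mem_weightCone (hproj v hv).1, ?_⟩)
            rw [hf, (hproj v hv).2, Int.cast_zero]
          · rw [map_zero]
            exact zero_mem _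
          · rw [map_add]
            exact add_mem hx hy
          · rw [map_smul]
            exact Submodule.smul_mem _ _ hx
        exact hle hy
      have h1 : π x = x := by
        simp only [π, LinearMap.add_apply, LinearMap.id_apply, LinearMap.smulRight_apply]
        rw [LinearMap.mem_ker.1 hx, zero_smul, add_zero]
      rw [← h1]
      exact hπ x
  obtain ⟨p₀, hp₀, hsat⟩ := exists_isSaturationPoint hP htop
  refine ⟨τ, ⟨⟨fun c hc => ((hτ c).1 hc).1, fun {x y a} hx hy ha hxy => (hτ x).2 ⟨hx, ?_⟩⟩, ?_⟩,
    p₀ + (L p₀).toNat • e, ⟨(hproj p₀ hp₀).1, ?_⟩, ?_⟩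
  · have h1 := ((hτ _).1 hxy).2
    rw [map_add, map_smul, smul_eq_mul] at h1
    have h2 := hfC x hx
    have h3 := hfC y hy
    have h4 : a * f x = 0 := le_antisymm (by linarith) (mul_nonneg ha.le h2)
    exact (mul_eq_zero.1 h4).resolve_left ha.ne'
  · rw [hspan, span_weightCone htop, finrank_top, finrank_ker_add_one hf0]
  -- Undo the slide: m - L(p₀)e lies in p₀ + σ^∨, so it is a weight, and its L-value is at least
  -- L(p₀), which allows L(p₀) steps of e back to m.
  · rintro m ⟨c, hc, hm⟩
    have h1 : toRat (m - (L p₀).toNat • e) = toRat p₀ + c := by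
      simp only [toRat_eq_toRatHom] at hm ⊢
      rw [map_sub, hm, map_add]
      abel
    have h2 := hsat _ ⟨c, hc, h1⟩
    have h3 : ((L p₀ : ℤ) : ℚ) ≤ ((L (m - (L p₀).toNat • e) : ℤ) : ℚ) := by
      rw [← hf, ← hf, h1, map_add]
      exact le_add_of_nonneg_right (hfC c hc)
    have h4 := hLe _ h2 (L p₀).toNat (by
      rw [Int.toNat_of_nonneg (hL p₀ hp₀)]
      exact_mod_cast h3)
    rwa [sub_add_cancel] at h4
  · exact (hτ _).2 ⟨toRat_mem_weightCone (hproj p₀ hp₀).1, by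
      rw [hf, (hproj p₀ hp₀).2, Int.cast_zero]⟩

/-- The additive function of a homogeneous locally nilpotent derivation is, up to a factor,
integral and nonnegative on the weight monoid. -/
theorem exists_integral_form {K : Type*} [Field K] [CharZero K]
    (htop : AddSubgroup.closure (P : Set (Fin n → ℤ)) = ⊤) {e : Fin n → ℤ} {ℓ : P →+ K}
    (hℓ0 : ℓ ≠ 0) (hadd : ∀ p : P, ℓ p ≠ 0 → (p : Fin n → ℤ) + e ∈ P)
    (hnil : ∀ p : P, ∃ (k : ℕ) (hk : ∀ j ≤ k, (p : Fin n → ℤ) + j • e ∈ P),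
      ℓ ⟨p + k • e, hk k le_rfl⟩ = 0) :
    ∃ L : (Fin n → ℤ) →+ ℤ, L e = -1 ∧ (∀ p ∈ P, 0 ≤ L p) ∧
      ∀ p ∈ P, ∀ j : ℕ, (j : ℤ) ≤ L p → p + j • e ∈ P := by
  obtain ⟨p₁, hp₁⟩ : ∃ p, ℓ p ≠ 0 := by
    by_contra! hcon
    exact hℓ0 (AddMonoidHom.ext hcon)
  obtain ⟨g, hg⟩ := exists_extension_closure P ℓ
  let g' : (Fin n → ℤ) →+ K := g.comp
    ((AddSubgroup.inclusion htop.ge).comp AddSubgroup.topEquiv.symm.toAddMonoidHom)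
  have hg' : ∀ p : P, g' p = ℓ p := fun p => hg p
  choose k hk hkℓ using hnil
  -- The zero of ℓ reached after k(p) steps makes -ℓ(p)/g'(e) equal to the natural number k(p). So
  -- k, although chosen pointwise, is additive.
  have hkc : ∀ p : P, ℓ p = -(k p * g' e) := by
    intro p
    have h1 := hkℓ p
    rw [← hg'] at h1
    change g' (p + k p • e) = 0 at h1
    rw [map_add, map_nsmul, hg', nsmul_eq_mul] at h1
    exact eq_neg_of_add_eq_zero_left h1
  have hc : g' e ≠ 0 := by
    intro h
    apply hp₁
    rw [hkc, h, mul_zero, neg_zero]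
  have hkinj : ∀ p : P, ((k p : ℕ) : K) = -(ℓ p / g' e) := by
    intro p
    rw [hkc p]
    field_simp
  let κ : P →+ ℤ :=
    { toFun := fun p => k p
      map_zero' := by
        have h1 := hkinj 0
        rw [map_zero, zero_div, neg_zero, Nat.cast_eq_zero] at h1
        exact_mod_cast h1
      map_add' := fun p q => by
        have h1 := hkinj (p + q)
        rw [map_add, add_div, neg_add, ← hkinj, ← hkinj] at h1
        exact_mod_cast h1 }
  obtain ⟨h, hh⟩ := exists_extension_closure P κ
  let L : (Fin n → ℤ) →+ ℤ := h.comp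
    ((AddSubgroup.inclusion htop.ge).comp AddSubgroup.topEquiv.symm.toAddMonoidHom)
  have hL : ∀ p : P, L p = k p := fun p => hh p
  refine ⟨L, ?_, fun p hp => ?_, fun p hp j hj => ?_⟩
  · have h1 : L e = L (⟨p₁ + e, hadd p₁ hp₁⟩ : P) - L p₁ := by
      rw [map_add, add_sub_cancel_left]
    rw [hL, hL] at h1
    have h2 : ((L e : ℤ) : K) = ((-1 : ℤ) : K) := by
      rw [h1]
      push_cast
      rw [hkinj, hkinj, ← hg' ⟨p₁ + e, hadd p₁ hp₁⟩]
      change -(g' (p₁ + e) / g' e) - _ = _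
      rw [map_add, hg']
      field_simp
      ring
    exact_mod_cast h2
  · have h1 := hL ⟨p, hp⟩
    change L p = _ at h1
    rw [h1]
    exact Int.natCast_nonneg _
  · have h1 := hL ⟨p, hp⟩
    change L p = _ at h1
    rw [h1] at hj
    exact hk ⟨p, hp⟩ j (by exact_mod_cast hj)

end Cone

end ToricRigidity

theorem mainTheorem2 {K : Type*} [Field K] [IsAlgClosed K] [CharZero K]
    {A : Type*} [CommRing A] [IsDomain A] [Algebra K A] [Algebra.FiniteType K A]
    (n : ℕ) (φ : (Fin n → Kˣ) →* (A ≃ₐ[K] A))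
    (hφ : ToricRigidity.IsAlgebraicAction (ToricRigidity.torusFunctions K n) φ)
    (x₀ : A →ₐ[K] K) (hx₀ : ToricRigidity.IsZariskiOpen (ToricRigidity.orbit φ x₀)) :
    (ToricRigidity.IsRigid K A ↔ ToricRigidity.smoothPoints K A = ToricRigidity.orbit φ x₀) ∧
    (Function.Injective φ →
      (ToricRigidity.IsRigid K A ↔
        ∀ τ : PointedCone ℚ (Fin n → ℚ),
          ToricRigidity.IsFacet τ (ToricRigidity.weightCone (ToricRigidity.weightMonoid φ)) →
            ToricRigidity.IsNowhereSaturated (ToricRigidity.weightMonoid φ) τ)) := by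
  open ToricRigidity in
  obtain ⟨b, hb0, hbm, hbφ, hbx⟩ := exists_weight_basis hφ hx₀
  have horb := mem_orbit_iff_forall_ne_zero b hb0 hbm hbφ hbx
  have hfg := fg_of_basis b hb0 hbm
  refine ⟨⟨fun hrigid => ?_, fun hsmooth ψ hψ => ?_⟩, fun hinj => ⟨fun hrigid τ hτ hsat => ?_,
    fun hfacet => ?_⟩⟩
  · apply Set.Subset.antisymm
    · intro x hx
      rw [horb]
      intro p hp
      exact not_isRigid_of_smooth_of_eq_zero hb0 hbm hx hp hrigid
    -- The dense orbit meets the generic smooth locus, and torus translations spread smoothness over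
    -- the whole orbit.
    · rintro y ⟨t, hy⟩
      obtain ⟨g, hg0, hg⟩ := exists_ne_zero_forall_mem_smoothPoints (K := K) (A := A)
      have hz : ∃ z ∈ orbit φ x₀, z g ≠ 0 := by
        by_contra! hcon
        exact hg0 (eq_zero_of_forall_mem_orbit hx₀ hcon)
      obtain ⟨z, ⟨s, hz⟩, hzg⟩ := hz
      have h1 := comp_mem_smoothPoints (φ (s⁻¹ * t)) (hg z hzg)
      have h2 : y = z.comp (φ (s⁻¹ * t) : A →ₐ[K] A) := by
        ext f
        have h3 : φ s (φ (s⁻¹ * t) f) = φ t f := by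
          conv_rhs => rw [← mul_inv_cancel_left s t, map_mul]
          rfl
        change y f = z (φ (s⁻¹ * t) f)
        rw [hy, hz, h3]
      rw [h2]
      exact h1
  -- Automorphisms preserve the smooth locus, here the orbit, so `b p` has no zero along the
  -- 𝔾ₐ-orbit of y and is constant on it.
  · have hfix : ∀ s p, ψ s (b p) = b p := by
      intro s p
      refine sub_eq_zero.1 (eq_zero_of_forall_mem_orbit hx₀ fun y hy => ?_)
      rw [map_sub, sub_eq_zero]
      refine hψ.apply_eq_of_forall_ne_zero y (b p) (fun s' => ?_) s
      have h1 : y.comp (ψ s' : A →ₐ[K] A) ∈ orbit φ x₀ := by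
        rw [← hsmooth] at hy ⊢
        exact comp_mem_smoothPoints _ hy
      exact (horb _).1 h1 p
    ext s f
    have hlin : (ψ s).toLinearMap = LinearMap.id := b.ext fun p => hfix s p
    exact LinearMap.congr_fun hlin f
  · obtain ⟨e, ℓ, h1, h2, p, hp⟩ := exists_degree_of_isAlmostSaturated hfg
      (closure_weightMonoid_eq_top b hbφ hinj) hτ hsat
    refine not_isRigid_of_degree (((Rat.castHom K : ℚ →+* K) : ℚ →+ K).comp ℓ) e hbm
      (fun p hp => h1 p fun h => hp ?_) h2 ⟨p, ?_⟩ hrigid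
    · change ((ℓ p : ℚ) : K) = 0
      rw [h, Rat.cast_zero]
    · change ((ℓ p : ℚ) : K) ≠ 0
      exact Rat.cast_ne_zero.2 hp
  · intro ψ hψ
    by_contra hne
    have htop := closure_weightMonoid_eq_top b hbφ hinj
    obtain ⟨D, hD0, hD⟩ := exists_derivation_of_action hψ hne
    obtain ⟨e, ℓ, hℓ0, hadd, hnil⟩ := exists_degree_of_derivation hfg hb0 hbm D hD0 hD
    obtain ⟨L, hLe, hL, hLP⟩ := exists_integral_form htop hℓ0 hadd hnil
    obtain ⟨τ, hτ, hsat⟩ := exists_facet_of_degree hfg htop L e hLe hL hLP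
    exact hfacet τ hτ hsat
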